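/- **Theorem 6.2.** Let $n\ge 3$ and let $(M,g)$ be a connected, paracompact, Hausdorff smooth $n$-dimensional Lorentzian manifold of signature $(-,+,\dots,+)$, with Levi-Civita connection $\nabla$, curvature tensor $R(X,Y)Z=\nabla_X\nabla_YZ-\nabla_Y\nabla_XZ-\nabla_{[X,Y]}Z$, Ricci tensor $S(Y,Z)=\operatorname{tr}\big(X\mapsto R(X,Y)Z\big)$ and Ricci operator $Q$, $g(QX,Y)=S(X,Y)$. Suppose that $M$ carries an $(LCS)_n$-structure, i.e. a smooth vector field $\xi$ with $g(\xi,\xi)=-1$ whose dual 1-form $\eta=g(\cdot,\xi)$ satisfies $$(\nabla_X\eta)(Y)=\alpha\{g(X,Y)+\eta(X)\eta(Y)\}$$ for a nowhere vanishing smooth function $\alpha$ with $d\alpha=\rho\,\eta$ for a function $\rho$ (so $\rho=-\xi\alpha$). Suppose that $g$ is a conformal Ricci soliton, i.e. $$\mathscr L_Vg+2S=\Big[2\lambda-\Big(p+\frac2n\Big)\Big]g$$ for a smooth vector field $V$ (for instance $V=\xi$) and scalars (functions or constants) $\lambda$ and $p$. Let $$\tilde M(X,Y)Z=R(X,Y)Z-\frac1{2(n-1)}\big[S(Y,Z)X-S(X,Z)Y+g(Y,Z)QX-g(X,Z)QY\big]$$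 be the $M$-projective curvature tensor, and suppose that $R(\xi,X)\cdot\tilde M=0$, that is, $$R(\xi,X)\tilde M(U,Y)W-\tilde M(R(\xi,X)U,Y)W-\tilde M(U,R(\xi,X)Y)W-\tilde M(U,Y)R(\xi,X)W=0$$ for all $X,U,Y,W$. If $\alpha^2-\rho$ vanishes nowhere, then $(M,g)$ is Einstein: $S=c\,g$ for a constant $c$. -/

import Mathlib

open Bundle VectorField FiberBundle
open scoped Manifold ContDiff Topology

noncomputable section

namespace LCS

/-- Vector fields (no regularity) on an `n`-dimensional manifold. -/
abbrev VField (n : ℕ) (M : Type*) [TopologicalSpace M]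
    [ChartedSpace (EuclideanSpace ℝ (Fin n)) M] [IsManifold (𝓡 n) ∞ M] : Type _ :=
  Π x : M, TangentSpace (𝓡 n) x

/-- A smooth Lorentzian metric, of signature `(-, +, ..., +)`, on an `n`-dimensional smooth
manifold. -/
structure LorentzMetric (n : ℕ) (M : Type*) [TopologicalSpace M]
    [ChartedSpace (EuclideanSpace ℝ (Fin n)) M] [IsManifold (𝓡 n) ∞ M] where
  /-- The scalar product on each tangent space. -/
  val (x : M) : TangentSpace (𝓡 n) x →L[ℝ] TangentSpace (𝓡 n) x →L[ℝ] ℝ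
  symm (x : M) (v w : TangentSpace (𝓡 n) x) : val x v w = val x w v
  signature (x : M) : ∃ b : Module.Basis (Fin n) ℝ (TangentSpace (𝓡 n) x),
    ∀ i j, val x (b i) (b j) = if i = j then (if (i : ℕ) = 0 then -1 else 1) else 0
  contMDiff : ContMDiff (𝓡 n)
    ((𝓡 n).prod 𝓘(ℝ, EuclideanSpace ℝ (Fin n) →L[ℝ] EuclideanSpace ℝ (Fin n) →L[ℝ] ℝ)) ∞
    (fun x ↦ TotalSpace.mk'
      (EuclideanSpace ℝ (Fin n) →L[ℝ] EuclideanSpace ℝ (Fin n) →L[ℝ] ℝ) x (val x))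

variable {n : ℕ} {M : Type*} [TopologicalSpace M]
  [ChartedSpace (EuclideanSpace ℝ (Fin n)) M] [IsManifold (𝓡 n) ∞ M]

/-- The vector field `X` is smooth. -/
def IsSmooth (X : VField n M) : Prop :=
  ContMDiff (𝓡 n) (𝓡 n).tangent ∞ (fun x ↦ (X x : TangentBundle (𝓡 n) M))

/-- The vector field `X` is differentiable at `x`. -/
abbrev DiffAt (X : VField n M) (x : M) : Prop :=
  MDifferentiableAt (𝓡 n) (𝓡 n).tangent (fun y ↦ (X y : TangentBundle (𝓡 n) M)) x

/-- The differential of a function at `x`, as a linear form on `T_x M`. -/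
abbrev dAt (n : ℕ) {M : Type*} [TopologicalSpace M]
    [ChartedSpace (EuclideanSpace ℝ (Fin n)) M] (f : M → ℝ) (x : M) :
    TangentSpace (𝓡 n) x →L[ℝ] ℝ :=
  mvfderiv (𝓡 n) f x

/-- The Lie bracket of vector fields. -/
abbrev bracket (X Y : VField n M) : VField n M := mlieBracket (𝓡 n) X Y

/-- The function `g(X, Y)` for two vector fields. -/
def LorentzMetric.inner (g : LorentzMetric n M) (X Y : VField n M) (x : M) : ℝ :=
  g.val x (X x) (Y x)

/-! ### The Levi-Civita connection -/

/-- Covariant derivatives on the tangent bundle; `D Y x (X x)` is `∇_X Y` at `x`. -/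
abbrev Connection (n : ℕ) (M : Type*) [TopologicalSpace M]
    [ChartedSpace (EuclideanSpace ℝ (Fin n)) M] [IsManifold (𝓡 n) ∞ M] : Type _ :=
  CovariantDerivative (𝓡 n) (EuclideanSpace ℝ (Fin n)) (fun x : M ↦ TangentSpace (𝓡 n) x)

/-- A covariant derivative on `TM` is a Levi-Civita connection of `g` if it is torsion-free and
compatible with `g`. -/
structure IsLeviCivita (g : LorentzMetric n M) (D : Connection n M) : Prop where
  torsion_free {X Y : VField n M} {x : M} (hX : DiffAt X x) (hY : DiffAt Y x) :
    D Y x (X x) - D X x (Y x) = bracket X Y x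
  metric {X Y : VField n M} {x : M} (hX : DiffAt X x) (hY : DiffAt Y x)
    (u : TangentSpace (𝓡 n) x) :
    dAt n (g.inner X Y) x u = g.val x (D X x u) (Y x) + g.val x (X x) (D Y x u)

/-- Half of the right-hand side of the Koszul formula. -/
def koszul (g : LorentzMetric n M) (X Y Z : VField n M) (x : M) : ℝ :=
  (1 / 2) * (dAt n (g.inner Y Z) x (X x) + dAt n (g.inner X Z) x (Y x)
    - dAt n (g.inner X Y) x (Z x)
    + g.val x (bracket X Y x) (Z x) - g.val x (bracket X Z x) (Y x)
    - g.val x (bracket Y Z x) (X x))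

section LeviCivita

instance (x : M) : T2Space (TangentSpace (𝓡 n) x) :=
  inferInstanceAs (T2Space (EuclideanSpace ℝ (Fin n)))

instance (x : M) : FiniteDimensional ℝ (TangentSpace (𝓡 n) x) :=
  inferInstanceAs (FiniteDimensional ℝ (EuclideanSpace ℝ (Fin n)))

variable {X X' Y Y' Z : VField n M} {x : M}

theorem LorentzMetric.nondegenerate (g : LorentzMetric n M) (x : M) (v : TangentSpace (𝓡 n) x)
    (h : ∀ w, g.val x v w = 0) : v = 0 := by
  obtain ⟨b, hb⟩ := g.signature x
  refine b.ext_elem fun j ↦ ?_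
  have h1 := h (b j)
  rw [← b.sum_repr v] at h1
  simp only [map_sum, map_smul, sum_apply, smul_apply, hb,
    smul_eq_mul, mul_ite, mul_zero, Finset.sum_ite_eq', Finset.mem_univ, if_true] at h1
  split_ifs at h1 <;> simpa using h1

theorem LorentzMetric.mdiff_inner (g : LorentzMetric n M) (hX : DiffAt X x) (hY : DiffAt Y x) :
    MDifferentiableAt (𝓡 n) 𝓘(ℝ) (g.inner X Y) x := by
  have h : MDifferentiableAt (𝓡 n) ((𝓡 n).prod 𝓘(ℝ))
      (fun m ↦ TotalSpace.mk' ℝ (E := Bundle.Trivial M ℝ) m (g.val m (X m) (Y m))) x :=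
    MDifferentiableAt.clm_bundle_apply₂ (F₁ := EuclideanSpace ℝ (Fin n))
      (F₂ := EuclideanSpace ℝ (Fin n)) (g.contMDiff.mdifferentiableAt (by simp)) hX hY
  simp only [mdifferentiableAt_totalSpace] at h
  exact h.2

theorem LorentzMetric.inner_comm (g : LorentzMetric n M) (X Y : VField n M) :
    g.inner X Y = g.inner Y X := funext fun x ↦ g.symm x _ _

theorem LorentzMetric.dAt_add (g : LorentzMetric n M)
    (hX : DiffAt X x) (hX' : DiffAt X' x) (hY : DiffAt Y x) (u : TangentSpace (𝓡 n) x) :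
    dAt n (g.inner (X + X') Y) x u = dAt n (g.inner X Y) x u + dAt n (g.inner X' Y) x u := by
  have h : g.inner (X + X') Y = g.inner X Y + g.inner X' Y := by
    ext y; simp [LorentzMetric.inner]
  rw [h, dAt, mvfderiv_add (g.mdiff_inner hX hY) (g.mdiff_inner hX' hY)]
  rfl

theorem LorentzMetric.dAt_smul (g : LorentzMetric n M) {f : M → ℝ}
    (hf : MDifferentiableAt (𝓡 n) 𝓘(ℝ) f x)
    (hX : DiffAt X x) (hY : DiffAt Y x) (u : TangentSpace (𝓡 n) x) :
    dAt n (g.inner (f • X) Y) x u =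
      f x * dAt n (g.inner X Y) x u + dAt n f x u * g.val x (X x) (Y x) := by
  have h : g.inner (f • X) Y = f * g.inner X Y := by
    ext y; simp [LorentzMetric.inner]
  rw [h, dAt, mvfderiv_mul hf (g.mdiff_inner hX hY)]
  simp [LorentzMetric.inner, mul_comm]

theorem koszul_add₁ (g : LorentzMetric n M) (hX : DiffAt X x) (hX' : DiffAt X' x)
    (hY : DiffAt Y x) (hZ : DiffAt Z x) :
    koszul g (X + X') Y Z x = koszul g X Y Z x + koszul g X' Y Z x := by
  simp only [koszul, bracket, g.dAt_add hX hX' hZ, g.dAt_add hX hX' hY,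
    mlieBracket_add_left hX hX', Pi.add_apply, map_add, add_apply]
  ring

theorem koszul_add₂ (g : LorentzMetric n M) (hX : DiffAt X x) (hY : DiffAt Y x)
    (hY' : DiffAt Y' x) (hZ : DiffAt Z x) :
    koszul g X (Y + Y') Z x = koszul g X Y Z x + koszul g X Y' Z x := by
  simp only [koszul, bracket, g.dAt_add hY hY' hZ, g.inner_comm X (Y + Y'), g.dAt_add hY hY' hX,
    mlieBracket_add_left hY hY', mlieBracket_add_right hY hY', Pi.add_apply, map_add, add_apply,
    g.inner_comm X]
  ring

theorem koszul_add₃ (g : LorentzMetric n M) (hX : DiffAt X x) (hY : DiffAt Y x)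
    (hZ : DiffAt Z x) {Z' : VField n M} (hZ' : DiffAt Z' x) :
    koszul g X Y (Z + Z') x = koszul g X Y Z x + koszul g X Y Z' x := by
  simp only [koszul, bracket, g.inner_comm _ (Z + Z'), g.dAt_add hZ hZ' hY, g.dAt_add hZ hZ' hX,
    mlieBracket_add_right hZ hZ', Pi.add_apply, map_add, add_apply,
    g.inner_comm Z, g.inner_comm Z']
  ring

theorem koszul_smul₁ (g : LorentzMetric n M) {f : M → ℝ}
    (hf : MDifferentiableAt (𝓡 n) 𝓘(ℝ) f x) (hX : DiffAt X x)
    (hY : DiffAt Y x) (hZ : DiffAt Z x) :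
    koszul g (f • X) Y Z x = f x * koszul g X Y Z x := by
  simp only [koszul, bracket, g.dAt_smul hf hX hZ, g.dAt_smul hf hX hY,
    mlieBracket_smul_left hf hX, Pi.smul_apply', map_add, map_smul, add_apply, smul_apply,
    smul_eq_mul, dAt]
  ring

theorem koszul_smul₂ (g : LorentzMetric n M) {f : M → ℝ}
    (hf : MDifferentiableAt (𝓡 n) 𝓘(ℝ) f x) (hX : DiffAt X x)
    (hY : DiffAt Y x) (hZ : DiffAt Z x) :
    koszul g X (f • Y) Z x =
      f x * koszul g X Y Z x + dAt n f x (X x) * g.val x (Y x) (Z x) := by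
  simp only [koszul, bracket, g.dAt_smul hf hY hZ, g.inner_comm X (f • Y), g.dAt_smul hf hY hX,
    mlieBracket_smul_left hf hY, mlieBracket_smul_right hf hY, Pi.smul_apply', map_add, map_smul,
    add_apply, smul_apply, smul_eq_mul, dAt, g.inner_comm Y X]
  rw [g.symm x (Y x) (X x)]
  ring

theorem koszul_smul₃ (g : LorentzMetric n M) {f : M → ℝ}
    (hf : MDifferentiableAt (𝓡 n) 𝓘(ℝ) f x) (hX : DiffAt X x)
    (hY : DiffAt Y x) (hZ : DiffAt Z x) :
    koszul g X Y (f • Z) x = f x * koszul g X Y Z x := by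
  simp only [koszul, bracket, g.inner_comm _ (f • Z), g.dAt_smul hf hZ hY, g.dAt_smul hf hZ hX,
    mlieBracket_smul_right hf hZ, Pi.smul_apply', map_add, map_smul,
    add_apply, smul_apply, smul_eq_mul, dAt, g.inner_comm Z]
  rw [g.symm x (Z x) (X x), g.symm x (Z x) (Y x)]
  ring

theorem koszul_swap (g : LorentzMetric n M) (X Y Z : VField n M) (x : M) :
    koszul g X Y Z x - koszul g Y X Z x = g.val x (bracket X Y x) (Z x) := by
  simp only [koszul, bracket, g.inner_comm Y X, mlieBracket_swap_apply (V := Y) (W := X),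
    map_neg, neg_apply]
  ring

theorem koszul_metric (g : LorentzMetric n M) (X Y Z : VField n M) (x : M) :
    koszul g Z X Y x + koszul g Z Y X x = dAt n (g.inner X Y) x (Z x) := by
  simp only [koszul, bracket, g.inner_comm Y X, mlieBracket_swap_apply (V := Y) (W := X),
    map_neg, neg_apply]
  ring

/-- The isomorphism `v ↦ g(v, ·)` from the tangent space to its dual. -/
def LorentzMetric.flat (g : LorentzMetric n M) (x : M) :
    TangentSpace (𝓡 n) x ≃ₗ[ℝ] (TangentSpace (𝓡 n) x →L[ℝ] ℝ) :=
  LinearEquiv.ofInjectiveOfFinrankEq (g.val x).toLinearMap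
    (by
      rw [← LinearMap.ker_eq_bot, LinearMap.ker_eq_bot']
      intro v hv
      exact g.nondegenerate x v fun w ↦ by simpa using congr($hv w))
    (by
      rw [← (LinearMap.toContinuousLinearMap (𝕜 := ℝ) (E := TangentSpace (𝓡 n) x)
        (F' := ℝ)).finrank_eq]
      exact Subspace.dual_finrank_eq.symm)

theorem LorentzMetric.flat_symm_apply (g : LorentzMetric n M) (x : M)
    (l : TangentSpace (𝓡 n) x →L[ℝ] ℝ) (w : TangentSpace (𝓡 n) x) :
    g.val x ((g.flat x).symm l) w = l w := by
  conv_rhs => rw [← (g.flat x).apply_symm_apply l]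
  rfl

theorem koszul_tensorial₁ (g : LorentzMetric n M) (hY : DiffAt Y x) (hZ : DiffAt Z x) :
    TensorialAt (𝓡 n) (EuclideanSpace ℝ (Fin n)) (fun X : VField n M ↦ koszul g X Y Z x) x where
  smul hf hX := koszul_smul₁ g hf hX hY hZ
  add hX hX' := koszul_add₁ g hX hX' hY hZ

theorem koszul_tensorial₃ (g : LorentzMetric n M) (hX : DiffAt X x) (hY : DiffAt Y x) :
    TensorialAt (𝓡 n) (EuclideanSpace ℝ (Fin n)) (fun Z : VField n M ↦ koszul g X Y Z x) x where
  smul hf hZ := koszul_smul₃ g hf hX hY hZ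
  add hZ hZ' := koszul_add₃ g hX hY hZ hZ'

open Classical in
/-- The covariant derivative given by the Koszul formula, as a bare function. -/
def koszulCov (g : LorentzMetric n M) (Y : VField n M) (x : M) :
    TangentSpace (𝓡 n) x →L[ℝ] TangentSpace (𝓡 n) x :=
  if hY : DiffAt Y x then
    LinearMap.toContinuousLinearMap
      ((g.flat x).symm.toLinearMap ∘ₗ
        (TensorialAt.mkHom₂ (fun X Z : VField n M ↦ koszul g X Y Z x) x
          (fun _ hZ ↦ koszul_tensorial₁ g hY hZ)
          (fun _ hX ↦ koszul_tensorial₃ g hX hY)).toLinearMap)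
  else 0

theorem koszulCov_apply (g : LorentzMetric n M) (hX : DiffAt X x) (hY : DiffAt Y x)
    (hZ : DiffAt Z x) : g.val x (koszulCov g Y x (X x)) (Z x) = koszul g X Y Z x := by
  rw [koszulCov, dif_pos hY]
  refine (g.flat_symm_apply x _ _).trans ?_
  exact TensorialAt.mkHom₂_apply (F := EuclideanSpace ℝ (Fin n)) (F' := EuclideanSpace ℝ (Fin n))
    (fun _ hZ ↦ koszul_tensorial₁ g hY hZ) (fun _ hX ↦ koszul_tensorial₃ g hX hY) hX hZ

theorem ext_of_inner (g : LorentzMetric n M) {v w : TangentSpace (𝓡 n) x}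
    (h : ∀ Z : VField n M, DiffAt Z x → g.val x v (Z x) = g.val x w (Z x)) : v = w := by
  rw [← sub_eq_zero]
  refine g.nondegenerate x _ fun z ↦ ?_
  have := h (extend (EuclideanSpace ℝ (Fin n)) z) (mdifferentiableAt_extend ..)
  rw [extend_apply_self] at this
  rw [map_sub, sub_apply, this, sub_self]

theorem hom_ext {A B : TangentSpace (𝓡 n) x →L[ℝ] TangentSpace (𝓡 n) x}
    (h : ∀ X : VField n M, DiffAt X x → A (X x) = B (X x)) : A = B := by
  ext1 u
  have := h (extend (EuclideanSpace ℝ (Fin n)) u) (mdifferentiableAt_extend ..)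
  rwa [extend_apply_self] at this

theorem DiffAt.add (hX : DiffAt X x) (hY : DiffAt Y x) : DiffAt (X + Y) x :=
  mdifferentiableAt_add_section hX hY

theorem DiffAt.smul {f : M → ℝ} (hf : MDifferentiableAt (𝓡 n) 𝓘(ℝ) f x) (hY : DiffAt Y x) :
    DiffAt (f • Y) x :=
  hf.smul_section hY

theorem exists_leviCivita (g : LorentzMetric n M) : ∃ D : Connection n M, IsLeviCivita g D := by
  refine ⟨⟨koszulCov g, ?_, ?_⟩, ?_, ?_⟩
  · intro Y Y' x hY hY' _
    refine hom_ext fun X hX ↦ ext_of_inner g fun Z hZ ↦ ?_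
    rw [koszulCov_apply g hX (DiffAt.add hY hY') hZ, koszul_add₂ g hX hY hY' hZ, add_apply,
      map_add, add_apply, koszulCov_apply g hX hY hZ, koszulCov_apply g hX hY' hZ]
  · intro Y f x hY hf _
    refine hom_ext fun X hX ↦ ext_of_inner g fun Z hZ ↦ ?_
    rw [koszulCov_apply g hX (DiffAt.smul hf hY) hZ, koszul_smul₂ g hf hX hY hZ]
    simp only [add_apply, smul_apply, map_add, map_smul, smul_eq_mul,
      ContinuousLinearMap.smulRight_apply, koszulCov_apply g hX hY hZ]
  · intro X Y x hX hY
    refine ext_of_inner g fun Z hZ ↦ ?_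
    change g.val x (koszulCov g Y x (X x) - koszulCov g X x (Y x)) (Z x) = _
    rw [map_sub, sub_apply, koszulCov_apply g hX hY hZ, koszulCov_apply g hY hX hZ, koszul_swap]
  · intro X Y x hX hY u
    have hU : DiffAt (extend (EuclideanSpace ℝ (Fin n)) u : VField n M) x :=
      mdifferentiableAt_extend ..
    have h := koszul_metric g X Y (extend (EuclideanSpace ℝ (Fin n)) u) x
    rw [← koszulCov_apply g hU hX hY, ← koszulCov_apply g hU hY hX, extend_apply_self] at h
    rw [← h, g.symm x (X x)]

end LeviCivita

/-- The Levi-Civita connection of `g`. -/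
def leviCivita (g : LorentzMetric n M) : Connection n M := (exists_leviCivita g).choose

theorem isLeviCivita_leviCivita (g : LorentzMetric n M) : IsLeviCivita g (leviCivita g) :=
  (exists_leviCivita g).choose_spec

/-! ### Curvature -/

/-- `R(X, Y)Z = ∇_X ∇_Y Z - ∇_Y ∇_X Z - ∇_[X,Y] Z` for vector fields. -/
def curvField (g : LorentzMetric n M) (X Y Z : VField n M) : VField n M := fun x ↦
  leviCivita g (fun y ↦ leviCivita g Z y (Y y)) x (X x)
    - leviCivita g (fun y ↦ leviCivita g Z y (X y)) x (Y x)
    - leviCivita g Z x (bracket X Y x)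

/-- The curvature tensor `R(u, v)w` on tangent vectors at `x`, computed on extensions of `u`, `v`,
`w` to vector fields that are smooth near `x` (the value does not depend on the extensions). -/
def curv (g : LorentzMetric n M) (x : M) (u v w : TangentSpace (𝓡 n) x) : TangentSpace (𝓡 n) x :=
  curvField g (extend (EuclideanSpace ℝ (Fin n)) u) (extend (EuclideanSpace ℝ (Fin n)) v)
    (extend (EuclideanSpace ℝ (Fin n)) w) x

/-- A `g`-orthonormal basis `e_0, ..., e_{n-1}` of `T_x M`, with `e_0` timelike. -/
def LorentzMetric.frame (g : LorentzMetric n M) (x : M) :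
    Module.Basis (Fin n) ℝ (TangentSpace (𝓡 n) x) :=
  (g.signature x).choose

/-- The sign `ε_i = g(e_i, e_i)` of the vectors of an orthonormal basis. -/
def sgn (i : Fin n) : ℝ := if (i : ℕ) = 0 then -1 else 1

/-- The Ricci tensor `S(v, w)`, the trace of `u ↦ R(u, v)w`, which in an orthonormal basis is
`∑ i, ε_i g(R(e_i, v)w, e_i)`. -/
def ricci (g : LorentzMetric n M) (x : M) (v w : TangentSpace (𝓡 n) x) : ℝ :=
  ∑ i, sgn i * g.val x (curv g x (g.frame x i) v w) (g.frame x i)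

/-- The Ricci operator `Q`, with `g(Q u, v) = S(u, v)`, expanded in an orthonormal basis. -/
def ricciOp (g : LorentzMetric n M) (x : M) (u : TangentSpace (𝓡 n) x) : TangentSpace (𝓡 n) x :=
  ∑ i, (sgn i * ricci g x u (g.frame x i)) • g.frame x i

/-- The `M`-projective curvature tensor. -/
def mProj (g : LorentzMetric n M) (x : M) (u v w : TangentSpace (𝓡 n) x) : TangentSpace (𝓡 n) x :=
  curv g x u v w - (1 / (2 * ((n : ℝ) - 1))) •
    (ricci g x v w • u - ricci g x u w • v
      + g.val x v w • ricciOp g x u - g.val x u w • ricciOp g x v)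

/-- `((R(a, b) · T)(u, v))w`, where the endomorphism `R(a, b)` acts as a derivation on a tensor `T`
of type (1,3). -/
def curvDot (g : LorentzMetric n M) (x : M) (a b : TangentSpace (𝓡 n) x)
    (T : TangentSpace (𝓡 n) x → TangentSpace (𝓡 n) x → TangentSpace (𝓡 n) x →
      TangentSpace (𝓡 n) x) (u v w : TangentSpace (𝓡 n) x) : TangentSpace (𝓡 n) x :=
  curv g x a b (T u v w) - T (curv g x a b u) v w - T u (curv g x a b v) w - T u v (curv g x a b w)

/-- The manifold is Einstein: the Ricci tensor is a constant multiple of the metric. -/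
def IsEinstein (g : LorentzMetric n M) : Prop :=
  ∃ c : ℝ, ∀ (x : M) (u v : TangentSpace (𝓡 n) x), ricci g x u v = c * g.val x u v

/-! ### Lorentzian concircular structures and conformal Ricci solitons -/

/-- The 1-form `g(·, ξ) = g(ξ, ·)`. -/
def dualForm (g : LorentzMetric n M) (ξ : VField n M) (x : M) : TangentSpace (𝓡 n) x →L[ℝ] ℝ :=
  g.val x (ξ x)

/-- `(∇_X η)(Y) = X(η(Y)) - η(∇_X Y)` at `x`, for a 1-form `η`. -/
def covForm (g : LorentzMetric n M) (η : Π x : M, TangentSpace (𝓡 n) x →L[ℝ] ℝ)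
    (X Y : VField n M) (x : M) : ℝ :=
  dAt n (fun y ↦ η y (Y y)) x (X x) - η x (leviCivita g Y x (X x))

/-- A Lorentzian concircular structure on a Lorentzian manifold: a unit timelike vector field `ξ`
whose dual 1-form `η = g(·, ξ)` satisfies `(∇_X η)(Y) = α (g(X, Y) + η(X) η(Y))` for a nowhere
vanishing function `α` with `dα = ρ η` for some function `ρ` (so `ρ = -ξα`). -/
structure LCSStructure (g : LorentzMetric n M) where
  ξ : VField n M
  α : M → ℝ
  ρ : M → ℝ
  smooth_ξ : IsSmooth ξ
  smooth_α : ContMDiff (𝓡 n) 𝓘(ℝ) ∞ α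
  unit_timelike (x : M) : g.val x (ξ x) (ξ x) = -1
  α_ne_zero (x : M) : α x ≠ 0
  concircular (X Y : VField n M) (x : M) (hX : DiffAt X x) (hY : DiffAt Y x) :
    covForm g (dualForm g ξ) X Y x =
      α x * (g.val x (X x) (Y x) + dualForm g ξ x (X x) * dualForm g ξ x (Y x))
  d_α (x : M) (u : TangentSpace (𝓡 n) x) : dAt n α x u = ρ x * dualForm g ξ x u

/-- The structure tensor `φ X = (1/α) ∇_X ξ`, which is determined by the other data. -/
def LCSStructure.φ {g : LorentzMetric n M} (L : LCSStructure g) (x : M) :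
    TangentSpace (𝓡 n) x →L[ℝ] TangentSpace (𝓡 n) x :=
  (1 / L.α x) • leviCivita g L.ξ x

/-- The Lie derivative `(L_V g)(X, Y) = V(g(X, Y)) - g([V, X], Y) - g(X, [V, Y])`. -/
def lieMetric (g : LorentzMetric n M) (V X Y : VField n M) (x : M) : ℝ :=
  dAt n (g.inner X Y) x (V x) - g.val x (bracket V X x) (Y x) - g.val x (X x) (bracket V Y x)

/-- The conformal Ricci soliton equation `L_V g + 2 S = (2 λ - (p + 2/n)) g`, for a smooth vector
field `V` and scalars `lam` and `p` (functions, in particular constants). -/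
structure IsConformalRicciSoliton (g : LorentzMetric n M) (V : VField n M) (lam p : M → ℝ) :
    Prop where
  smooth : IsSmooth V
  eqn (X Y : VField n M) (x : M) (hX : DiffAt X x) (hY : DiffAt Y x) :
    lieMetric g V X Y x + 2 * ricci g x (X x) (Y x) =
      (2 * lam x - (p x + 2 / (n : ℝ))) * g.val x (X x) (Y x)

end LCS

end

/-!
# An `(LCS)_n`-manifold with `R(ξ, X) · M̃ = 0` is Einstein

Write `κ = α² - ρ`. Since `∇_u ξ = α (u + η(u) ξ)`, the curvature satisfies
`R(u, v)ξ = κ (η(v) u - η(u) v)` (`LCSStructure.curv_xi`), and by pair symmetry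
`R(ξ, u)v = κ (g(u, v) ξ - η(v) u)` (`LCSStructure.curv_xi_left`). So `R(ξ, X) · M̃ = 0` is a purely
algebraic condition at each point, with a factor `κ ≠ 0`. Its component along `ξ` expresses `M̃`
through the metric, `η` and the bilinear form `E = (κ/2) g - S / (2 (n - 1))`
(`LCSStructure.inner_mProj`). A contraction gives `(2n - 1) E = (tr E) (g + η ⊗ η)`, and another
contraction gives `(2n - 1) tr E = (n - 1) tr E`; hence `E = 0`, that is `S = (n - 1) κ g`
(`LCSStructure.ricci_eq`). Put back into the formula for `M̃`, this shows that the curvature is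
pointwise constant, `R(u, v)w = κ (g(v, w) u - g(u, w) v)` (`LCSStructure.curv_eq`). Schur's lemma
(`dAt_eq_zero_of_curv_eq`), a consequence of the second Bianchi identity in dimension at least
three, then gives `dκ = 0`, and `κ` is constant because the manifold is connected.

The general facts about the Levi-Civita connection are developed for vector fields that are
smooth at the given point (`SmoothAt`): the fields `∇_X Y` are again smooth (`SmoothAt.cov`),
by the Koszul formula and the invertibility of the Gram matrix of a local frame; the Lie bracket is
the commutator of derivations (`dAt_bracket`); the curvature of fields depends only on their values
(`curvField_apply`), is trilinear, has the usual symmetries (`curv_bianchi`, `curv_skew`,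
`curv_pair`), and satisfies the second Bianchi identity (`curvField_bianchi`).
-/

noncomputable section

namespace LCS

variable {n : ℕ} {M : Type*} [TopologicalSpace M]
  [ChartedSpace (EuclideanSpace ℝ (Fin n)) M] [IsManifold (𝓡 n) ∞ M]

/-! ### Smooth vector fields -/

variable {X X' Y Y' Z Z' W : VField n M} {f : M → ℝ} {x : M}

/-- The vector field `X` is `C^∞` at `x`: for each finite `k` it is `C^k` on a neighbourhood of `x`,
which may depend on `k`. -/
abbrev SmoothAt (X : VField n M) (x : M) : Prop :=
  ContMDiffAt (𝓡 n) (𝓡 n).tangent ∞ (fun y ↦ (X y : TangentBundle (𝓡 n) M)) x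

/-- The extension of a tangent vector at `x` to a vector field which is smooth near `x`, the one
used in the definition of `curv`. -/
abbrev extAt {x : M} (u : TangentSpace (𝓡 n) x) : VField n M :=
  extend (EuclideanSpace ℝ (Fin n)) u

/-- The vector field `∇_X Y`, with the arguments in the usual order. -/
def cov (g : LorentzMetric n M) (X Y : VField n M) : VField n M :=
  fun y ↦ leviCivita g Y y (X y)

theorem SmoothAt.diffAt (hX : SmoothAt X x) : DiffAt X x :=
  hX.mdifferentiableAt (by simp)

theorem SmoothAt.eventually_diffAt (hX : SmoothAt X x) : ∀ᶠ y in 𝓝 x, DiffAt X y := by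
  have h : ContMDiffAt (𝓡 n) (𝓡 n).tangent 1 (fun y ↦ (X y : TangentBundle (𝓡 n) M)) x :=
    hX.of_le (by simp)
  filter_upwards [(contMDiffAt_iff_contMDiffAt_nhds (by simp)).1 h] with y hy
  exact hy.mdifferentiableAt (by simp)

theorem eventually_mdifferentiableAt (hf : ContMDiffAt (𝓡 n) 𝓘(ℝ) ∞ f x) :
    ∀ᶠ y in 𝓝 x, MDifferentiableAt (𝓡 n) 𝓘(ℝ) f y := by
  have h : ContMDiffAt (𝓡 n) 𝓘(ℝ) 1 f x := hf.of_le (by simp)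
  filter_upwards [(contMDiffAt_iff_contMDiffAt_nhds (by simp)).1 h] with y hy
  exact hy.mdifferentiableAt (by simp)

theorem SmoothAt.add (hX : SmoothAt X x) (hY : SmoothAt Y x) : SmoothAt (X + Y) x :=
  ContMDiffAt.add_section hX hY

theorem SmoothAt.sub (hX : SmoothAt X x) (hY : SmoothAt Y x) : SmoothAt (X - Y) x :=
  ContMDiffAt.sub_section hX hY

theorem SmoothAt.smul (hf : ContMDiffAt (𝓡 n) 𝓘(ℝ) ∞ f x) (hX : SmoothAt X x) :
    SmoothAt (f • X) x :=
  ContMDiffAt.smul_section hf hX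

theorem smoothAt_extAt (u : TangentSpace (𝓡 n) x) : SmoothAt (extAt u) x :=
  contMDiffAt_extend ..

theorem eventually_smoothAt_extAt (u : TangentSpace (𝓡 n) x) :
    ∀ᶠ y in 𝓝 x, SmoothAt (extAt u) y := by
  obtain ⟨s, hs, h⟩ := exists_contMDiffOn_extend (k := ∞) (𝓡 n) (EuclideanSpace ℝ (Fin n)) u
  filter_upwards [eventually_eventually_nhds.2 hs] with y hy
  exact h.contMDiffAt hy

theorem extAt_apply (u : TangentSpace (𝓡 n) x) : extAt u x = u := extend_apply_self ..

/-- The derivative of a smooth function along a smooth field is smooth. -/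
theorem smoothAt_dAt (hf : ContMDiffAt (𝓡 n) 𝓘(ℝ) ∞ f x) (hX : SmoothAt X x) :
    ContMDiffAt (𝓡 n) 𝓘(ℝ) ∞ (fun y ↦ dAt n f y (X y)) x := by
  have h := hf.mfderiv_const (m := ∞) (by simp)
  have h2 := ContMDiffAt.clm_apply_of_inCoordinates (E₁ := fun y : M ↦ TangentSpace (𝓡 n) y)
    (E₂ := fun y : ℝ ↦ TangentSpace 𝓘(ℝ) y) (b₁ := fun y : M ↦ y) (b₂ := f) (v := X)
    (ϕ := fun y ↦ mfderiv (𝓡 n) 𝓘(ℝ) f y) h hX hf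
  rw [contMDiffAt_totalSpace] at h2
  exact h2.2.congr_of_eventuallyEq (Filter.Eventually.of_forall fun y ↦ by simp [mvfderiv]; rfl)

theorem smoothAt_inner (g : LorentzMetric n M) (hX : SmoothAt X x) (hY : SmoothAt Y x) :
    ContMDiffAt (𝓡 n) 𝓘(ℝ) ∞ (g.inner X Y) x := by
  have h : ContMDiffAt (𝓡 n) ((𝓡 n).prod 𝓘(ℝ)) ∞
      (fun m ↦ TotalSpace.mk' ℝ (E := Bundle.Trivial M ℝ) m (g.val m (X m) (Y m))) x :=
    ContMDiffAt.clm_bundle_apply₂ (F₁ := EuclideanSpace ℝ (Fin n))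
      (F₂ := EuclideanSpace ℝ (Fin n)) g.contMDiff.contMDiffAt hX hY
  rw [contMDiffAt_totalSpace] at h
  exact h.2

theorem SmoothAt.bracket (hX : SmoothAt X x) (hY : SmoothAt Y x) : SmoothAt (bracket X Y) x := by
  have : IsManifold (𝓡 n) (minSmoothness ℝ 2) M := by
    simp only [minSmoothness_of_isRCLikeNormedField]
    exact IsManifold.of_le (n := ∞) (by norm_cast)
  have : IsManifold (𝓡 n) (((⊤ : ℕ∞) : WithTop ℕ∞) + 1) M := by simpa
  exact ContMDiffAt.mlieBracket_vectorField (n := (⊤ : ℕ∞)) (m := (⊤ : ℕ∞)) hX hY (by simp)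

theorem bracket_jacobi (hX : SmoothAt X x) (hY : SmoothAt Y x) (hZ : SmoothAt Z x) :
    bracket X (bracket Y Z) x = bracket (bracket X Y) Z x + bracket Y (bracket X Z) x := by
  have : IsManifold (𝓡 n) (minSmoothness ℝ 3) M := by
    simp only [minSmoothness_of_isRCLikeNormedField]
    exact IsManifold.of_le (n := ∞) (by norm_cast)
  have h2 : minSmoothness ℝ 2 ≤ ∞ := by
    simp only [minSmoothness_of_isRCLikeNormedField]
    norm_cast
  exact leibniz_identity_mlieBracket_apply (hX.of_le h2) (hY.of_le h2) (hZ.of_le h2)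

theorem bracket_swap (X Y : VField n M) (x : M) : bracket X Y x = - bracket Y X x :=
  mlieBracket_swap_apply

theorem bracket_jacobi_cyclic (hX : SmoothAt X x) (hY : SmoothAt Y x) (hZ : SmoothAt Z x) :
    bracket X (bracket Y Z) x + bracket Y (bracket Z X) x + bracket Z (bracket X Y) x = 0 := by
  have e1 : bracket (bracket X Y) Z x = - bracket Z (bracket X Y) x := bracket_swap ..
  have e2 : bracket Y (bracket X Z) x = - bracket Y (bracket Z X) x := by
    have : bracket X Z = - bracket Z X := funext fun y ↦ bracket_swap X Z y
    rw [this]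
    have h := mlieBracket_const_smul_right (I := 𝓡 n) (V := Y) (c := (-1 : ℝ))
      (hZ.bracket hX).diffAt
    simpa [bracket] using h
  rw [bracket_jacobi hX hY hZ, e1, e2]
  abel

/-- The Koszul formula. -/
theorem inner_cov (g : LorentzMetric n M) (hX : DiffAt X x) (hY : DiffAt Y x) (hZ : DiffAt Z x) :
    g.inner (cov g X Y) Z x = koszul g X Y Z x := by
  have D := isLeviCivita_leviCivita g
  have h1 := D.metric hY hZ (X x)
  have h2 := D.metric hX hZ (Y x)
  have h3 := D.metric hX hY (Z x)
  have t1 := D.torsion_free hX hY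
  have t2 := D.torsion_free hX hZ
  have t3 := D.torsion_free hY hZ
  simp only [koszul, LorentzMetric.inner, cov, ← t1, ← t2, ← t3, map_sub, sub_apply] at *
  rw [h1, h2, h3]
  simp only [g.symm x (Y x), g.symm x (X x)]
  ring


/-! ### Smoothness of covariant derivatives -/

/-- The Gram determinant test: a family of vectors as long as the dimension whose Gram matrix is
invertible separates tangent vectors. -/
theorem eq_of_gram (g : LorentzMetric n M) {e : Fin n → TangentSpace (𝓡 n) x}
    (h : (Matrix.of fun i j ↦ g.val x (e i) (e j)).det ≠ 0) {v w : TangentSpace (𝓡 n) x}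
    (hvw : ∀ i, g.val x v (e i) = g.val x w (e i)) : v = w := by
  have hli : LinearIndependent ℝ e := by
    rw [Fintype.linearIndependent_iff]
    intro a ha
    have : a = 0 := by
      refine Matrix.eq_zero_of_mulVec_eq_zero h (funext fun i ↦ ?_)
      have h1 : g.val x (e i) (∑ j, a j • e j) = 0 := by rw [ha, map_zero]
      simpa [Matrix.mulVec, dotProduct, mul_comm] using h1
    simp [this]
  let b := basisOfLinearIndependentOfCardEqFinrank' e hli (by
    change Fintype.card (Fin n) = Module.finrank ℝ (EuclideanSpace ℝ (Fin n)); simp)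
  have hb : ∀ i, b i = e i := fun i ↦ by simp [b]
  rw [← sub_eq_zero]
  refine g.nondegenerate x _ fun z ↦ ?_
  rw [← b.sum_repr z]
  simp [hb, hvw]

theorem smoothAt_det {ι : Type*} [Fintype ι] [DecidableEq ι] {a : M → Matrix ι ι ℝ}
    (ha : ∀ i j, ContMDiffAt (𝓡 n) 𝓘(ℝ) ∞ (fun y ↦ a y i j) x) :
    ContMDiffAt (𝓡 n) 𝓘(ℝ) ∞ (fun y ↦ (a y).det) x := by
  simp only [Matrix.det_apply']
  refine contMDiffAt_finsetSum fun σ _ ↦ contMDiffAt_const.mul ?_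
  exact contMDiffAt_finsetProd fun i _ ↦ ha _ _

theorem smoothAt_inv {ι : Type*} [Fintype ι] [DecidableEq ι] {a : M → Matrix ι ι ℝ}
    (ha : ∀ i j, ContMDiffAt (𝓡 n) 𝓘(ℝ) ∞ (fun y ↦ a y i j) x) (h : (a x).det ≠ 0) (i j : ι) :
    ContMDiffAt (𝓡 n) 𝓘(ℝ) ∞ (fun y ↦ (a y)⁻¹ i j) x := by
  simp only [Matrix.inv_def, Ring.inverse_eq_inv', Matrix.smul_apply, smul_eq_mul,
    Matrix.adjugate_apply]
  refine ((smoothAt_det ha).inv₀ h).mul (smoothAt_det fun k l ↦ ?_)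
  by_cases hk : k = j
  · subst hk
    simpa using contMDiffAt_const
  · simpa [Matrix.updateRow_ne hk] using ha k l

/-- A vector field is smooth as soon as its scalar products with smooth fields are: its components
in a smooth local frame are obtained from these by the inverse of the Gram matrix. -/
theorem smoothAt_of_inner (g : LorentzMetric n M)
    (h : ∀ Z, SmoothAt Z x → ContMDiffAt (𝓡 n) 𝓘(ℝ) ∞ (g.inner W Z) x) : SmoothAt W x := by
  let e : Fin n → VField n M := fun i ↦ extAt (g.frame x i)
  let a : M → Matrix (Fin n) (Fin n) ℝ := fun y ↦ Matrix.of fun i j ↦ g.val y (e i y) (e j y)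
  have he : ∀ i, SmoothAt (e i) x := fun i ↦ smoothAt_extAt _
  have ha : ∀ i j, ContMDiffAt (𝓡 n) 𝓘(ℝ) ∞ (fun y ↦ a y i j) x := fun i j ↦
    smoothAt_inner g (he i) (he j)
  -- The frame is orthonormal at `x`, so its Gram matrix is invertible at and near `x`.
  have hx : (a x).det ≠ 0 := by
    have : a x = Matrix.diagonal fun i ↦ sgn i := by
      ext i j
      simp only [a, e, Matrix.of_apply, extAt_apply, Matrix.diagonal_apply, sgn]
      exact (g.signature x).choose_spec i j
    rw [this, Matrix.det_diagonal, Finset.prod_ne_zero_iff]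
    intro i _
    unfold sgn
    split_ifs <;> norm_num
  have hev : ∀ᶠ y in 𝓝 x, (a y).det ≠ 0 :=
    (smoothAt_det ha).continuousAt.eventually_ne hx
  have hs : SmoothAt (fun y ↦ ∑ i, (∑ j, (a y)⁻¹ i j * g.inner W (e j) y) • e i y) x := by
    refine ContMDiffAt.sum_section fun i _ ↦ ?_
    refine SmoothAt.smul (f := fun y ↦ ∑ j, (a y)⁻¹ i j * g.inner W (e j) y) ?_ (he i)
    exact contMDiffAt_finsetSum fun j _ ↦ (smoothAt_inv ha hx i j).mul (h _ (he j))
  refine hs.congr_of_eventuallyEq ?_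
  filter_upwards [hev] with y hy
  congr 1
  refine eq_of_gram g (e := fun i ↦ e i y) hy fun k ↦ ?_
  have hinv : a y * (a y)⁻¹ = 1 := Matrix.mul_nonsing_inv _ (Ne.isUnit hy)
  have h1 : (a y).mulVec ((a y)⁻¹.mulVec fun j ↦ g.inner W (e j) y) k = g.inner W (e k) y := by
    rw [Matrix.mulVec_mulVec, hinv, Matrix.one_mulVec]
  simp only [Matrix.mulVec, dotProduct] at h1
  rw [LorentzMetric.inner] at h1
  rw [← h1, map_sum, sum_apply]
  refine Finset.sum_congr rfl fun i _ ↦ ?_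
  rw [map_smul, smul_apply, smul_eq_mul, mul_comm, g.symm]
  rfl

theorem SmoothAt.koszul (g : LorentzMetric n M) (hX : SmoothAt X x) (hY : SmoothAt Y x)
    (hZ : SmoothAt Z x) : ContMDiffAt (𝓡 n) 𝓘(ℝ) ∞ (koszul g X Y Z) x := by
  have h1 := smoothAt_dAt (smoothAt_inner g hY hZ) hX
  have h2 := smoothAt_dAt (smoothAt_inner g hX hZ) hY
  have h3 := smoothAt_dAt (smoothAt_inner g hX hY) hZ
  have h4 := smoothAt_inner g (hX.bracket hY) hZ
  have h5 := smoothAt_inner g (hX.bracket hZ) hY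
  have h6 := smoothAt_inner g (hY.bracket hZ) hX
  exact contMDiffAt_const.mul (((((h1.add h2).sub h3).add h4).sub h5).sub h6)

theorem SmoothAt.cov (g : LorentzMetric n M) (hX : SmoothAt X x) (hY : SmoothAt Y x) :
    SmoothAt (cov g X Y) x := by
  refine smoothAt_of_inner g fun Z hZ ↦ ?_
  refine (hX.koszul g hY hZ).congr_of_eventuallyEq ?_
  filter_upwards [hX.eventually_diffAt, hY.eventually_diffAt, hZ.eventually_diffAt] with y h1 h2 h3
  exact inner_cov g h1 h2 h3

/-- The Lie bracket acts on functions as the commutator of derivations. With a field `Z` that does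
not vanish at `x`, this is the coefficient of `Z` in the Jacobi identity for `X`, `Y`, `f • Z`. -/
theorem dAt_bracket (hn : 0 < n) (hf : ContMDiffAt (𝓡 n) 𝓘(ℝ) ∞ f x) (hX : SmoothAt X x)
    (hY : SmoothAt Y x) :
    dAt n f x (bracket X Y x) =
      dAt n (fun y ↦ dAt n f y (Y y)) x (X x) - dAt n (fun y ↦ dAt n f y (X y)) x (Y x) := by
  have : Nonempty (Fin n) := ⟨⟨0, hn⟩⟩
  have : Nontrivial (TangentSpace (𝓡 n) x) :=
    inferInstanceAs (Nontrivial (EuclideanSpace ℝ (Fin n)))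
  obtain ⟨v, hv⟩ := exists_ne (0 : TangentSpace (𝓡 n) x)
  have hZ := smoothAt_extAt v
  set Z : VField n M := extAt v
  have hfd : ∀ᶠ y in 𝓝 x, MDifferentiableAt (𝓡 n) 𝓘(ℝ) f y :=
    eventually_mdifferentiableAt hf
  have key : ∀ {X Y : VField n M}, SmoothAt X x → SmoothAt Y x →
      bracket X (bracket Y (f • Z)) x = dAt n (fun y ↦ dAt n f y (Y y)) x (X x) • Z x
        + dAt n f x (Y x) • bracket X Z x + dAt n f x (X x) • bracket Y Z x
        + f x • bracket X (bracket Y Z) x := by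
    intro X Y hX hY
    have h1 : (bracket Y (f • Z)) =ᶠ[𝓝 x]
        ((fun y ↦ dAt n f y (Y y)) • Z + f • bracket Y Z : VField n M) := by
      filter_upwards [hfd, hZ.eventually_diffAt] with y h1 h2
      exact mlieBracket_smul_right h1 h2
    have h2 : bracket X (bracket Y (f • Z)) x = bracket X
        ((fun y ↦ dAt n f y (Y y)) • Z + f • bracket Y Z : VField n M) x :=
      Filter.EventuallyEq.mlieBracket_vectorField_eq (Filter.EventuallyEq.rfl) h1
    rw [h2, bracket, mlieBracket_add_right
      (SmoothAt.smul (smoothAt_dAt hf hY) hZ).diffAt (SmoothAt.smul hf (hY.bracket hZ)).diffAt,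
      mlieBracket_smul_right ((smoothAt_dAt hf hY).mdifferentiableAt (by simp)) hZ.diffAt,
      mlieBracket_smul_right hfd.self_of_nhds (hY.bracket hZ).diffAt]
    simp only [add_assoc]
  have h1 := bracket_jacobi hX hY (SmoothAt.smul hf hZ)
  have h2 := bracket_jacobi hX hY hZ
  have h3 : bracket (bracket X Y) (f • Z) x = _ :=
    mlieBracket_smul_right hfd.self_of_nhds hZ.diffAt
  rw [key hX hY, key hY hX, h3, h2] at h1
  have h4 : (dAt n f x (bracket X Y x) - (dAt n (fun y ↦ dAt n f y (Y y)) x (X x)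
      - dAt n (fun y ↦ dAt n f y (X y)) x (Y x))) • Z x = 0 := by
    simp only [dAt, bracket, smul_add] at h1 ⊢
    rw [← sub_eq_zero] at h1
    rw [← neg_eq_zero, ← h1]
    module
  have hZx : Z x ≠ 0 := by simpa [Z, extAt_apply] using hv
  exact sub_eq_zero.1 ((smul_eq_zero.1 h4).resolve_right hZx)

/-! ### Calculus of covariant derivatives -/

theorem cov_add_left (g : LorentzMetric n M) : cov g (X + X') Y = cov g X Y + cov g X' Y := by
  ext1 y; simp [cov]

theorem cov_smul_left (g : LorentzMetric n M) : cov g (f • X) Y = f • cov g X Y := by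
  ext1 y; simp [cov]

theorem cov_add_right (g : LorentzMetric n M) (hY : DiffAt Y x) (hY' : DiffAt Y' x) :
    cov g X (Y + Y') x = cov g X Y x + cov g X Y' x := by
  simp only [cov]
  rw [(leviCivita g).isCovariantDerivativeOnUniv.add hY hY', add_apply]

theorem cov_smul_right (g : LorentzMetric n M) (hf : MDifferentiableAt (𝓡 n) 𝓘(ℝ) f x)
    (hY : DiffAt Y x) :
    cov g X (f • Y) x = f x • cov g X Y x + dAt n f x (X x) • Y x := by
  simp only [cov]
  rw [(leviCivita g).isCovariantDerivativeOnUniv.leibniz hY hf]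
  simp

theorem cov_sub_right (g : LorentzMetric n M) (hY : DiffAt Y x) (hY' : DiffAt Y' x) :
    cov g X (Y - Y') x = cov g X Y x - cov g X Y' x := by
  have h := cov_add_right g (X := X) (Y := Y - Y') (Y' := Y')
    (mdifferentiableAt_sub_section hY hY') hY'
  rw [sub_add_cancel] at h
  exact eq_sub_of_add_eq h.symm

theorem cov_congr (g : LorentzMetric n M) (hY : DiffAt Y x) (hY' : DiffAt Y' x)
    (h : Y =ᶠ[𝓝 x] Y') : cov g X Y x = cov g X Y' x := by
  simp only [cov]
  rw [(leviCivita g).isCovariantDerivativeOnUniv.congr_of_eventuallyEq hY hY' Filter.univ_mem h]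

theorem cov_torsion (g : LorentzMetric n M) (hX : DiffAt X x) (hY : DiffAt Y x) :
    cov g X Y x - cov g Y X x = bracket X Y x :=
  (isLeviCivita_leviCivita g).torsion_free hX hY

theorem curvField_eq (g : LorentzMetric n M) (X Y Z : VField n M) :
    curvField g X Y Z = cov g X (cov g Y Z) - cov g Y (cov g X Z) - cov g (bracket X Y) Z := rfl

theorem SmoothAt.curvField (g : LorentzMetric n M) (hX : SmoothAt X x) (hY : SmoothAt Y x)
    (hZ : SmoothAt Z x) : SmoothAt (curvField g X Y Z) x :=
  ((hX.cov g (hY.cov g hZ)).sub (hY.cov g (hX.cov g hZ))).sub ((hX.bracket hY).cov g hZ)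

theorem curvField_swap (g : LorentzMetric n M) (X Y Z : VField n M) (x : M) :
    curvField g X Y Z x = - curvField g Y X Z x := by
  simp only [curvField, bracket_swap X Y x, map_neg]
  abel

/-! ### Tensoriality of the curvature -/

/-- An operation on vector fields, with values in a real vector space, that is additive and
homogeneous over functions, for fields and functions that are smooth at `x`. (`TensorialAt` asks for
this under mere differentiability at `x`, which is too much for the curvature.) -/
structure SmoothTensorialAt {A : Type*} [AddCommGroup A] [Module ℝ A] (Φ : VField n M → A)
    (x : M) : Prop where
  smul {f : M → ℝ} {X : VField n M} (hf : ContMDiffAt (𝓡 n) 𝓘(ℝ) ∞ f x) (hX : SmoothAt X x) :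
    Φ (f • X) = f x • Φ X
  add {X Y : VField n M} (hX : SmoothAt X x) (hY : SmoothAt Y x) : Φ (X + Y) = Φ X + Φ Y

namespace SmoothTensorialAt

variable {A : Type*} [AddCommGroup A] [Module ℝ A] {Φ : VField n M → A}

/-- A tensorial operation depends only on the germ of the field. -/
theorem congr_germ (h : SmoothTensorialAt Φ x) (hX : SmoothAt X x) (hY : SmoothAt Y x)
    (hXY : X =ᶠ[𝓝 x] Y) : Φ X = Φ Y := by
  classical
  -- The indicator function of the set where the fields agree has the germ of a constant at `x`.
  let ψ : M → ℝ := fun y ↦ if X y = Y y then 1 else 0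
  have hψx : ψ x = 1 := by simp [ψ, hXY.self_of_nhds]
  have he : ψ • X = ψ • Y := by
    ext1 y
    by_cases hy : X y = Y y <;> simp [ψ, hy]
  have hψ : ContMDiffAt (𝓡 n) 𝓘(ℝ) ∞ ψ x := by
    have : ContMDiffAt (𝓡 n) 𝓘(ℝ) ∞ (fun _ : M ↦ (1 : ℝ)) x := contMDiffAt_const
    exact this.congr_of_eventuallyEq (hXY.mono fun y hy ↦ by simp [ψ, hy])
  have h1 := h.smul hψ hX
  rw [he, h.smul hψ hY, hψx, one_smul, one_smul] at h1
  exact h1.symm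

theorem map_sum (h : SmoothTensorialAt Φ x) {ι : Type*} (s : Finset ι) {σ : ι → VField n M}
    (hσ : ∀ i, SmoothAt (σ i) x) : Φ (∑ i ∈ s, σ i) = ∑ i ∈ s, Φ (σ i) := by
  classical
  have hs : ∀ s : Finset ι, SmoothAt (∑ i ∈ s, σ i) x := fun s ↦ by
    have := ContMDiffAt.sum_section (s := s) (I := 𝓡 n) (t := σ) (n := ∞) (x₀ := x)
      fun i _ ↦ hσ i
    simpa only [SmoothAt, Finset.sum_apply] using this
  induction s using Finset.induction_on with
  | empty =>
    have h0 : SmoothAt (0 : VField n M) x := by simpa using hs ∅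
    have := h.smul (f := fun _ ↦ 0) contMDiffAt_const h0
    simpa using this
  | insert a s ha ih => rw [Finset.sum_insert ha, Finset.sum_insert ha, h.add (hσ a) (hs s), ih]

/-- A tensorial operation depends only on the value of the field at `x`, as one sees by expanding
the field in a smooth local frame. -/
theorem pointwise (h : SmoothTensorialAt Φ x) (hX : SmoothAt X x) (hY : SmoothAt Y x)
    (hXY : X x = Y x) : Φ X = Φ Y := by
  let t := trivializationAt (EuclideanSpace ℝ (Fin n)) (fun y : M ↦ TangentSpace (𝓡 n) y) x
  have hx : x ∈ t.baseSet := FiberBundle.mem_baseSet_trivializationAt' x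
  let b := Module.finBasis ℝ (EuclideanSpace ℝ (Fin n))
  let s := t.localFrame b
  let c := t.localFrameCoeff (𝓡 n) b
  have hs : ∀ i, SmoothAt (s i) x := fun i ↦ contMDiffAt_localFrame_of_mem ∞ _ b i hx
  have hc : ∀ {X : VField n M}, SmoothAt X x → ∀ i,
      ContMDiffAt (𝓡 n) 𝓘(ℝ) ∞ (LinearMap.piApply (c i) X) x := fun hX i ↦
    contMDiffAt_localFrameCoeff b hx hX i
  have key : ∀ {X : VField n M}, SmoothAt X x → Φ X = ∑ i, c i x (X x) • Φ (s i) := by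
    intro X hX
    have h1 : ∀ i, SmoothAt (LinearMap.piApply (c i) X • s i : VField n M) x :=
      fun i ↦ SmoothAt.smul (hc hX i) (hs i)
    have h2 : X =ᶠ[𝓝 x] ∑ i, (LinearMap.piApply (c i) X • s i : VField n M) := by
      have h0 := t.eventually_eq_localFrame_sum_coeff_smul (I := 𝓡 n) (s := X) b hx
      filter_upwards [h0] with y hy
      refine hy.trans ?_
      exact (Finset.sum_apply (M := fun y : M ↦ TangentSpace (𝓡 n) y) y Finset.univ
        fun i ↦ (LinearMap.piApply (c i) X • s i : VField n M)).symm
    have h3 : SmoothAt (∑ i, (LinearMap.piApply (c i) X • s i : VField n M)) x :=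
      hX.congr_of_eventuallyEq (h2.symm.mono fun y hy ↦ congrArg (TotalSpace.mk y) hy)
    rw [h.congr_germ hX h3 h2, h.map_sum _ h1]
    exact Finset.sum_congr rfl fun i _ ↦ h.smul (hc hX i) (hs i)
  rw [key hX, key hY, hXY]

end SmoothTensorialAt

/-- A tensorial operation induces a linear map on the tangent space. -/
def SmoothTensorialAt.toLinearMap {A : Type*} [AddCommGroup A] [Module ℝ A] {Φ : VField n M → A}
    (h : SmoothTensorialAt Φ x) : TangentSpace (𝓡 n) x →ₗ[ℝ] A where
  toFun u := Φ (extAt u)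
  map_add' u v := by
    rw [← h.add (smoothAt_extAt u) (smoothAt_extAt v)]
    exact h.pointwise (smoothAt_extAt _) ((smoothAt_extAt u).add (smoothAt_extAt v))
      (by simp only [Pi.add_apply, extAt_apply])
  map_smul' c u := by
    rw [RingHom.id_apply, ← h.smul (f := fun _ ↦ c) contMDiffAt_const (smoothAt_extAt u)]
    exact h.pointwise (smoothAt_extAt _) (SmoothAt.smul contMDiffAt_const (smoothAt_extAt u))
      (by simp only [Pi.smul_apply', extAt_apply])

/-- The curvature is tensorial in its first argument. -/
theorem curvField_tensorial₁ (g : LorentzMetric n M) (hZ : SmoothAt Z x) :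
    SmoothTensorialAt (fun X ↦ curvField g X Y Z x) x where
  smul {f X} hf hX := by
    have hf' := hf.mdifferentiableAt (n := ∞) (by simp)
    have h1 : bracket (f • X) Y x = _ := mlieBracket_smul_left hf' hX.diffAt
    have h2 : cov g (bracket (f • X) Y) Z x = leviCivita g Z x (bracket (f • X) Y x) := rfl
    have h3 : cov g (bracket X Y) Z x = leviCivita g Z x (bracket X Y x) := rfl
    simp only [curvField_eq, Pi.sub_apply, cov_smul_left,
      cov_smul_right g hf' (hX.cov g hZ).diffAt, Pi.smul_apply', h2, h1, h3, map_add, map_smul,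
      neg_smul, map_neg]
    simp only [cov, dAt, bracket]
    module
  add {X X'} hX hX' := by
    have h1 : bracket (X + X') Y x = _ := mlieBracket_add_left hX.diffAt hX'.diffAt
    have h2 : cov g (bracket (X + X') Y) Z x = leviCivita g Z x (bracket (X + X') Y x) := rfl
    simp only [curvField_eq, Pi.sub_apply, cov_add_left,
      cov_add_right g (hX.cov g hZ).diffAt (hX'.cov g hZ).diffAt, Pi.add_apply, h2, h1, map_add]
    simp only [cov, bracket]
    module

/-- The curvature is tensorial in its second argument. -/
theorem curvField_tensorial₂ (g : LorentzMetric n M) (hZ : SmoothAt Z x) :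
    SmoothTensorialAt (fun Y ↦ curvField g X Y Z x) x where
  smul {f Y} hf hY := by
    rw [curvField_swap g X, (curvField_tensorial₁ g hZ).smul hf hY, curvField_swap g X, smul_neg]
  add {Y Y'} hY hY' := by
    rw [curvField_swap g X, (curvField_tensorial₁ g hZ).add hY hY', curvField_swap g X,
      curvField_swap g X Y', neg_add]

theorem cov_cov_smul (g : LorentzMetric n M) (hf : ContMDiffAt (𝓡 n) 𝓘(ℝ) ∞ f x)
    (hY : SmoothAt Y x) (hZ : SmoothAt Z x) :
    cov g X (cov g Y (f • Z)) x = f x • cov g X (cov g Y Z) x + dAt n f x (X x) • cov g Y Z x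
      + dAt n f x (Y x) • cov g X Z x + dAt n (fun y ↦ dAt n f y (Y y)) x (X x) • Z x := by
  have h1 : cov g Y (f • Z) =ᶠ[𝓝 x] (f • cov g Y Z + (fun y ↦ dAt n f y (Y y)) • Z) := by
    filter_upwards [eventually_mdifferentiableAt hf, hZ.eventually_diffAt] with y h1 h2
    exact cov_smul_right g h1 h2
  have hd := smoothAt_dAt hf hY
  have h2 := SmoothAt.smul hf (hY.cov g hZ)
  have h3 := SmoothAt.smul hd hZ
  rw [cov_congr g (hY.cov g (SmoothAt.smul hf hZ)).diffAt (h2.add h3).diffAt h1,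
    cov_add_right g h2.diffAt h3.diffAt,
    cov_smul_right g (hf.mdifferentiableAt (by simp)) (hY.cov g hZ).diffAt,
    cov_smul_right g (hd.mdifferentiableAt (by simp)) hZ.diffAt]
  abel

/-- The curvature is tensorial in its third argument: the terms with second derivatives of the
coefficient cancel because the Lie bracket is the commutator of derivations. -/
theorem curvField_tensorial₃ (hn : 0 < n) (g : LorentzMetric n M) (hX : SmoothAt X x)
    (hY : SmoothAt Y x) : SmoothTensorialAt (fun Z ↦ curvField g X Y Z x) x where
  smul {f Z} hf hZ := by
    simp only [curvField_eq, Pi.sub_apply, cov_cov_smul g hf hY hZ, cov_cov_smul g hf hX hZ,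
      cov_smul_right g (hf.mdifferentiableAt (n := ∞) (by simp)) hZ.diffAt,
      dAt_bracket hn hf hX hY]
    module
  add {Z Z'} hZ hZ' := by
    have key : ∀ {X Y : VField n M}, SmoothAt X x → SmoothAt Y x →
        cov g X (cov g Y (Z + Z')) x = cov g X (cov g Y Z) x + cov g X (cov g Y Z') x := by
      intro X Y hX hY
      have h1 : cov g Y (Z + Z') =ᶠ[𝓝 x] cov g Y Z + cov g Y Z' := by
        filter_upwards [hZ.eventually_diffAt, hZ'.eventually_diffAt] with y h1 h2
        exact cov_add_right g h1 h2
      rw [cov_congr g (hY.cov g (hZ.add hZ')).diffAt ((hY.cov g hZ).add (hY.cov g hZ')).diffAt h1,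
        cov_add_right g (hY.cov g hZ).diffAt (hY.cov g hZ').diffAt]
    simp only [curvField_eq, Pi.sub_apply, key hX hY, key hY hX,
      cov_add_right g hZ.diffAt hZ'.diffAt]
    abel

/-- The curvature of vector fields at `x` depends only on their values at `x`. -/
theorem curvField_apply (hn : 0 < n) (g : LorentzMetric n M) (hX : SmoothAt X x)
    (hY : SmoothAt Y x) (hZ : SmoothAt Z x) :
    curvField g X Y Z x = curv g x (X x) (Y x) (Z x) := by
  have eX := smoothAt_extAt (X x)
  have eY := smoothAt_extAt (Y x)
  rw [(curvField_tensorial₁ g hZ).pointwise hX eX (extAt_apply _).symm,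
    (curvField_tensorial₂ g hZ).pointwise hY eY (extAt_apply _).symm,
    (curvField_tensorial₃ hn g eX eY).pointwise hZ (smoothAt_extAt (Z x)) (extAt_apply _).symm]
  rfl

/-- The curvature tensor at `x` as a trilinear map. -/
def curvHom (hn : 0 < n) (g : LorentzMetric n M) (x : M) :
    TangentSpace (𝓡 n) x →ₗ[ℝ] TangentSpace (𝓡 n) x →ₗ[ℝ] TangentSpace (𝓡 n) x →ₗ[ℝ]
      TangentSpace (𝓡 n) x :=
  LinearMap.mk₂ ℝ
    (fun u v ↦ (curvField_tensorial₃ hn g (smoothAt_extAt u) (smoothAt_extAt v)).toLinearMap)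
    (fun u u' v ↦ LinearMap.ext fun w ↦
      (curvField_tensorial₁ g (Y := extAt v) (smoothAt_extAt w)).toLinearMap.map_add u u')
    (fun c u v ↦ LinearMap.ext fun w ↦
      (curvField_tensorial₁ g (Y := extAt v) (smoothAt_extAt w)).toLinearMap.map_smul c u)
    (fun u v v' ↦ LinearMap.ext fun w ↦
      (curvField_tensorial₂ g (X := extAt u) (smoothAt_extAt w)).toLinearMap.map_add v v')
    (fun c u v ↦ LinearMap.ext fun w ↦
      (curvField_tensorial₂ g (X := extAt u) (smoothAt_extAt w)).toLinearMap.map_smul c v)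

theorem curvHom_apply (hn : 0 < n) (g : LorentzMetric n M) (x : M)
    (u v w : TangentSpace (𝓡 n) x) : curvHom hn g x u v w = curv g x u v w := rfl

/-! ### Symmetries of the curvature -/

theorem curv_swap (g : LorentzMetric n M) (u v w : TangentSpace (𝓡 n) x) :
    curv g x u v w = - curv g x v u w := curvField_swap ..

theorem cov_cov_sub (g : LorentzMetric n M) (hY : SmoothAt Y x)
    (hZ : SmoothAt Z x) :
    cov g X (cov g Y Z) x - cov g X (cov g Z Y) x = cov g X (bracket Y Z) x := by
  rw [← cov_sub_right g (hY.cov g hZ).diffAt (hZ.cov g hY).diffAt]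
  refine cov_congr g ((hY.cov g hZ).sub (hZ.cov g hY)).diffAt (hY.bracket hZ).diffAt ?_
  filter_upwards [hY.eventually_diffAt, hZ.eventually_diffAt] with y h1 h2
  exact cov_torsion g h1 h2

/-- The first Bianchi identity: as the torsion vanishes, it is the Jacobi identity for three
extensions of the vectors. -/
theorem curv_bianchi (g : LorentzMetric n M) (u v w : TangentSpace (𝓡 n) x) :
    curv g x u v w + curv g x v w u + curv g x w u v = 0 := by
  have hX := smoothAt_extAt u
  have hY := smoothAt_extAt v
  have hZ := smoothAt_extAt w
  change curvField g (extAt u) (extAt v) (extAt w) x + curvField g (extAt v) (extAt w) (extAt u) x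
    + curvField g (extAt w) (extAt u) (extAt v) x = 0
  set X : VField n M := extAt u
  set Y : VField n M := extAt v
  set Z : VField n M := extAt w
  have h1 := cov_cov_sub (X := X) g hY hZ
  have h2 := cov_cov_sub (X := Y) g hZ hX
  have h3 := cov_cov_sub (X := Z) g hX hY
  have t1 := cov_torsion g hX.diffAt (hY.bracket hZ).diffAt
  have t2 := cov_torsion g hY.diffAt (hZ.bracket hX).diffAt
  have t3 := cov_torsion g hZ.diffAt (hX.bracket hY).diffAt
  have hj := bracket_jacobi_cyclic hX hY hZ
  rw [← t1, ← t2, ← t3, ← h1, ← h2, ← h3] at hj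
  simp only [curvField_eq, Pi.sub_apply]
  rw [← hj]
  abel

theorem dAt_congr {f' : M → ℝ} (h : f =ᶠ[𝓝 x] f') : dAt n f x = dAt n f' x := by
  ext1 u
  exact congr($(h.mfderiv_eq (I := 𝓡 n) (I' := 𝓘(ℝ))) u)

/-- The second derivative of a scalar product, by compatibility with the metric. -/
theorem dAt_dAt_inner (g : LorentzMetric n M) (hY : SmoothAt Y x)
    (hZ : SmoothAt Z x) (hW : SmoothAt W x) :
    dAt n (fun y ↦ dAt n (g.inner Z W) y (Y y)) x (X x) =
      g.val x (cov g X (cov g Y Z) x) (W x) + g.val x (cov g Y Z x) (cov g X W x)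
      + g.val x (cov g X Z x) (cov g Y W x) + g.val x (Z x) (cov g X (cov g Y W) x) := by
  have D := isLeviCivita_leviCivita g
  have h1 : (fun y ↦ dAt n (g.inner Z W) y (Y y)) =ᶠ[𝓝 x]
      g.inner (cov g Y Z) W + g.inner Z (cov g Y W) := by
    filter_upwards [hZ.eventually_diffAt, hW.eventually_diffAt] with y h1 h2
    exact D.metric h1 h2 (Y y)
  have h2 : dAt n (fun y ↦ dAt n (g.inner Z W) y (Y y)) x =
      dAt n (g.inner (cov g Y Z) W + g.inner Z (cov g Y W)) x :=
    dAt_congr h1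
  rw [h2, dAt, mvfderiv_add ((smoothAt_inner g (hY.cov g hZ) hW).mdifferentiableAt (by simp))
    ((smoothAt_inner g hZ (hY.cov g hW)).mdifferentiableAt (by simp))]
  have h3 := D.metric (hY.cov g hZ).diffAt hW.diffAt (X x)
  have h4 := D.metric hZ.diffAt (hY.cov g hW).diffAt (X x)
  simp only [dAt, add_apply] at h3 h4 ⊢
  rw [h3, h4]
  simp only [cov]
  ring

/-- The endomorphism `R(u, v)` is skew-adjoint: this is the identity `[X, Y]f = XYf - YXf` for the
function `f = g(Z, W)`. -/
theorem curv_skew (hn : 0 < n) (g : LorentzMetric n M) (u v w z : TangentSpace (𝓡 n) x) :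
    g.val x (curv g x u v w) z = - g.val x w (curv g x u v z) := by
  have hX := smoothAt_extAt u
  have hY := smoothAt_extAt v
  have hZ := smoothAt_extAt w
  have hW := smoothAt_extAt z
  have key : g.val x (curvField g (extAt u) (extAt v) (extAt w) x) (extAt z x) =
      - g.val x (extAt w x) (curvField g (extAt u) (extAt v) (extAt z) x) := by
    have h := dAt_bracket hn (smoothAt_inner g hZ hW) hX hY
    rw [dAt_dAt_inner g hY hZ hW, dAt_dAt_inner g hX hZ hW,
      (isLeviCivita_leviCivita g).metric hZ.diffAt hW.diffAt] at h
    simp only [curvField_eq, Pi.sub_apply, map_sub, sub_apply]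
    simp only [cov] at h ⊢
    linarith
  rw [extAt_apply, extAt_apply] at key
  exact key

/-- The pair symmetry of the curvature. -/
theorem curv_pair (hn : 0 < n) (g : LorentzMetric n M) (u v w z : TangentSpace (𝓡 n) x) :
    g.val x (curv g x u v w) z = g.val x (curv g x w z u) v := by
  have b : ∀ u v w z, g.val x (curv g x u v w) z + g.val x (curv g x v w u) z
      + g.val x (curv g x w u v) z = 0 := fun u v w z ↦ by
    rw [← add_apply, ← add_apply, ← map_add, ← map_add, curv_bianchi, map_zero]; rfl
  have s : ∀ u v w z, g.val x (curv g x u v w) z = - g.val x (curv g x v u w) z :=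
    fun u v w z ↦ by rw [curv_swap, map_neg]; rfl
  have k : ∀ u v w z, g.val x (curv g x u v w) z = - g.val x (curv g x u v z) w :=
    fun u v w z ↦ by rw [curv_skew hn, g.symm]
  -- A combination of the four instances of the first Bianchi identity for `u`, `v`, `w`, `z`.
  linarith [b u v w z, b v w z u, b w z u v, b z u v w, s u v w z, s v w u z, s w u v z,
    k u v w z, k v w u z, k w u v z, s v w z u, s w z v u, s z v w u, k v w z u, k w z v u,
    k z v w u, s w z u v, s z u w v, s u w z v, k w z u v, k z u w v, k u w z v,
    s z u v w, s u v z w, s v z u w, k z u v w, k u v z w, k v z u w]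

/-- The second Bianchi identity, for vector fields: after expansion of the commutators of covariant
derivatives, what is left over vanishes by the Jacobi identity. -/
theorem curvField_bianchi (g : LorentzMetric n M) (hX : SmoothAt X x) (hY : SmoothAt Y x)
    (hZ : SmoothAt Z x) (hW : SmoothAt W x) :
    (cov g X (curvField g Y Z W) x - curvField g Y Z (cov g X W) x)
      + (cov g Y (curvField g Z X W) x - curvField g Z X (cov g Y W) x)
      + (cov g Z (curvField g X Y W) x - curvField g X Y (cov g Z W) x) =
    curvField g (bracket Y Z) X W x + curvField g (bracket Z X) Y W x
      + curvField g (bracket X Y) Z W x := by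
  have key : ∀ {X Y Z : VField n M}, SmoothAt X x → SmoothAt Y x → SmoothAt Z x →
      cov g X (curvField g Y Z W) x = cov g X (cov g Y (cov g Z W)) x
        - cov g X (cov g Z (cov g Y W)) x - cov g X (cov g (bracket Y Z) W) x := by
    intro X Y Z hX hY hZ
    rw [curvField_eq, cov_sub_right g _ ((hY.bracket hZ).cov g hW).diffAt, cov_sub_right g
      (hY.cov g (hZ.cov g hW)).diffAt (hZ.cov g (hY.cov g hW)).diffAt]
    exact ((hY.cov g (hZ.cov g hW)).sub (hZ.cov g (hY.cov g hW))).diffAt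
  have hj := bracket_jacobi_cyclic hX hY hZ
  have h3 : cov g (bracket X (bracket Y Z)) W x + cov g (bracket Y (bracket Z X)) W x
      + cov g (bracket Z (bracket X Y)) W x = 0 := by
    simp only [cov]
    rw [← map_add, ← map_add, hj, map_zero]
  rw [key hX hY hZ, key hY hZ hX, key hZ hX hY]
  simp only [curvField_swap g (bracket _ _), curvField_eq, Pi.sub_apply]
  rw [← sub_eq_zero, ← neg_eq_zero, ← h3]
  abel

/-! ### Orthonormal frames and the Ricci tensor -/

theorem LorentzMetric.frame_inner (g : LorentzMetric n M) (x : M) (i j : Fin n) :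
    g.val x (g.frame x i) (g.frame x j) = if i = j then sgn i else 0 :=
  (g.signature x).choose_spec i j

theorem sgn_mul_self (i : Fin n) : sgn i * sgn i = 1 := by
  unfold sgn; split_ifs <;> norm_num

/-- The expansion of a vector in an orthonormal frame. -/
theorem LorentzMetric.sum_frame (g : LorentzMetric n M) (x : M) (u : TangentSpace (𝓡 n) x) :
    ∑ i, (sgn i * g.val x (g.frame x i) u) • g.frame x i = u := by
  rw [← sub_eq_zero]
  refine g.nondegenerate x _ fun w ↦ ?_
  have : ∀ j, g.val x (∑ i, (sgn i * g.val x (g.frame x i) u) • g.frame x i - u)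
      (g.frame x j) = 0 := by
    intro j
    simp only [map_sub, map_sum, map_smul, sub_apply, sum_apply,
      smul_apply, smul_eq_mul, g.frame_inner, mul_ite, mul_zero,
      Finset.sum_ite_eq', Finset.mem_univ, if_true]
    rw [g.symm x u, mul_right_comm, sgn_mul_self, one_mul, sub_self]
  rw [← (g.frame x).sum_repr w]
  simp only [map_sum, map_smul, this, smul_zero, Finset.sum_const_zero]

/-- Contraction of a linear form with the metric in an orthonormal frame. -/
theorem LorentzMetric.sum_frame_mul (g : LorentzMetric n M) (x : M)
    (l : TangentSpace (𝓡 n) x →ₗ[ℝ] ℝ) (u : TangentSpace (𝓡 n) x) :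
    ∑ i, sgn i * (g.val x (g.frame x i) u * l (g.frame x i)) = l u := by
  conv_rhs => rw [← g.sum_frame x u]
  simp only [map_sum, map_smul, smul_eq_mul, mul_assoc]

theorem LorentzMetric.sum_frame_inner (g : LorentzMetric n M) (x : M) :
    ∑ i, sgn i * g.val x (g.frame x i) (g.frame x i) = n := by
  simp [g.frame_inner, sgn_mul_self]

/-- The Ricci tensor at `x` as a bilinear map. -/
def ricciHom (hn : 0 < n) (g : LorentzMetric n M) (x : M) :
    TangentSpace (𝓡 n) x →ₗ[ℝ] TangentSpace (𝓡 n) x →ₗ[ℝ] ℝ :=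
  LinearMap.mk₂ ℝ (ricci g x)
    (fun u u' w ↦ by
      simp only [ricci, ← curvHom_apply hn, map_add, LinearMap.add_apply, add_apply, mul_add,
        Finset.sum_add_distrib])
    (fun c u w ↦ by
      simp only [ricci, ← curvHom_apply hn, map_smul, LinearMap.smul_apply, smul_apply,
        smul_eq_mul, Finset.mul_sum, mul_left_comm c])
    (fun u w w' ↦ by
      simp only [ricci, ← curvHom_apply hn, map_add, add_apply, mul_add,
        Finset.sum_add_distrib])
    (fun c u w ↦ by
      simp only [ricci, ← curvHom_apply hn, map_smul, smul_apply,
        smul_eq_mul, Finset.mul_sum, mul_left_comm c])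

theorem ricciHom_apply (hn : 0 < n) (g : LorentzMetric n M) (u v : TangentSpace (𝓡 n) x) :
    ricciHom hn g x u v = ricci g x u v := rfl

theorem ricci_symm (hn : 0 < n) (g : LorentzMetric n M) (u v : TangentSpace (𝓡 n) x) :
    ricci g x u v = ricci g x v u := by
  refine Finset.sum_congr rfl fun i _ ↦ ?_
  rw [curv_pair hn, curv_swap, map_neg, neg_apply, curv_skew hn, neg_neg, g.symm]

theorem inner_ricciOp (hn : 0 < n) (g : LorentzMetric n M) (u v : TangentSpace (𝓡 n) x) :
    g.val x v (ricciOp g x u) = ricci g x u v := by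
  rw [← ricciHom_apply hn, ← g.sum_frame_mul x (ricciHom hn g x u) v, ricciOp, map_sum]
  refine Finset.sum_congr rfl fun i _ ↦ ?_
  rw [map_smul, smul_eq_mul, ricciHom_apply, g.symm]
  ring

/-! ### Lorentzian concircular structures -/

variable {g : LorentzMetric n M} (L : LCSStructure g)

/-- The function `κ = α² - ρ`, for which `R(u, v)ξ = κ (η(v) u - η(u) v)`. -/
def LCSStructure.kappa (x : M) : ℝ := L.α x ^ 2 - L.ρ x

/-- `∇_u ξ = α (u + η(u) ξ)`: the concircular condition, with the index of `η` raised. -/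
theorem LCSStructure.nabla_xi (x : M) (u : TangentSpace (𝓡 n) x) :
    leviCivita g L.ξ x u = L.α x • (u + g.val x (L.ξ x) u • L.ξ x) := by
  have hξ : SmoothAt L.ξ x := L.smooth_ξ x
  refine ext_of_inner g fun Y hY ↦ ?_
  have h1 := L.concircular (extAt u) Y x (smoothAt_extAt u).diffAt hY
  have h2 := (isLeviCivita_leviCivita g).metric hξ.diffAt hY u
  have h3 : dAt n (fun y ↦ g.val y (L.ξ y) (Y y)) x u = dAt n (g.inner L.ξ Y) x u := rfl
  simp only [covForm, dualForm, extAt_apply] at h1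
  simp only [map_smul, map_add, smul_apply, add_apply, smul_eq_mul]
  linarith

theorem LCSStructure.cov_xi (X : VField n M) :
    cov g X L.ξ = L.α • (X + g.inner L.ξ X • L.ξ) := by
  ext1 y; exact L.nabla_xi y (X y)

/-- The function `ρ = -ξα` is smooth. -/
theorem LCSStructure.smooth_ρ (x : M) : ContMDiffAt (𝓡 n) 𝓘(ℝ) ∞ L.ρ x := by
  have h := smoothAt_dAt (L.smooth_α x) (L.smooth_ξ x)
  refine h.neg.congr_of_eventuallyEq (Filter.Eventually.of_forall fun y ↦ ?_)
  simp [L.d_α, dualForm, L.unit_timelike]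

theorem LCSStructure.smooth_kappa (x : M) : ContMDiffAt (𝓡 n) 𝓘(ℝ) ∞ L.kappa x :=
  ((L.smooth_α x).pow 2).sub (L.smooth_ρ x)

theorem LCSStructure.cov_cov_xi (hY : SmoothAt Y x) :
    cov g X (cov g Y L.ξ) x =
      L.α x • (cov g X Y x + g.val x (L.ξ x) (cov g X Y x) • L.ξ x)
      + (L.α x ^ 2 * (g.val x (X x) (Y x) + g.val x (L.ξ x) (X x) * g.val x (L.ξ x) (Y x))) • L.ξ x
      + (L.α x ^ 2 * g.val x (L.ξ x) (Y x)) • (X x + g.val x (L.ξ x) (X x) • L.ξ x)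
      + (L.ρ x * g.val x (L.ξ x) (X x)) • (Y x + g.val x (L.ξ x) (Y x) • L.ξ x) := by
  have hξ : SmoothAt L.ξ x := L.smooth_ξ x
  have hη := smoothAt_inner g hξ hY
  have h1 := SmoothAt.smul hη hξ
  have h2 := (isLeviCivita_leviCivita g).metric hξ.diffAt hY.diffAt (X x)
  have h3 : cov g X L.ξ x = _ := L.nabla_xi x (X x)
  rw [L.cov_xi, cov_smul_right g ((L.smooth_α x).mdifferentiableAt (by simp)) (hY.add h1).diffAt,
    cov_add_right g hY.diffAt h1.diffAt,
    cov_smul_right g (hη.mdifferentiableAt (by simp)) hξ.diffAt, h2, L.nabla_xi, h3, L.d_α]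
  simp only [LorentzMetric.inner, Pi.add_apply, Pi.smul_apply', map_smul, map_add, smul_apply,
    add_apply, smul_eq_mul, dualForm, cov]
  module

theorem LCSStructure.curv_xi (hn : 0 < n) (u v : TangentSpace (𝓡 n) x) :
    curv g x u v (L.ξ x) =
      L.kappa x • (g.val x (L.ξ x) v • u - g.val x (L.ξ x) u • v) := by
  have hX := smoothAt_extAt u
  have hY := smoothAt_extAt v
  have h := curvField_apply hn g hX hY (L.smooth_ξ x)
  rw [extAt_apply, extAt_apply] at h
  have h3 : cov g (bracket (extAt u) (extAt v)) L.ξ x = _ :=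
    L.nabla_xi x (bracket (extAt u) (extAt v) x)
  rw [← h, curvField_eq, Pi.sub_apply, Pi.sub_apply, L.cov_cov_xi hY, L.cov_cov_xi hX, h3,
    ← cov_torsion g hX.diffAt hY.diffAt]
  simp only [extAt_apply, map_sub, kappa, g.symm x v u]
  module

theorem LCSStructure.inner_xi_curv (hn : 0 < n) (u v w : TangentSpace (𝓡 n) x) :
    g.val x (L.ξ x) (curv g x u v w) =
      L.kappa x * (g.val x (L.ξ x) u * g.val x v w - g.val x (L.ξ x) v * g.val x u w) := by
  rw [g.symm, curv_skew hn, L.curv_xi hn, g.symm]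
  simp only [map_sub, map_smul, sub_apply, smul_apply, smul_eq_mul]
  ring

theorem LCSStructure.curv_xi_left (hn : 0 < n) (u v : TangentSpace (𝓡 n) x) :
    curv g x (L.ξ x) u v =
      L.kappa x • (g.val x u v • L.ξ x - g.val x (L.ξ x) v • u) := by
  rw [← sub_eq_zero]
  refine g.nondegenerate x _ fun w ↦ ?_
  rw [map_sub, sub_apply, curv_pair hn, L.curv_xi hn]
  simp only [map_sub, map_smul, sub_apply, smul_apply, smul_eq_mul, g.symm x v u, g.symm x w u]
  ring

theorem LCSStructure.ricci_xi (hn : 0 < n) (u : TangentSpace (𝓡 n) x) :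
    ricci g x u (L.ξ x) = (n - 1) * L.kappa x * g.val x (L.ξ x) u := by
  have h := g.sum_frame_mul x (g.val x (L.ξ x)).toLinearMap u
  have h2 := g.sum_frame_inner x
  simp only [ContinuousLinearMap.coe_coe] at h
  calc ricci g x u (L.ξ x)
      = ∑ i, (L.kappa x * g.val x (L.ξ x) u * (sgn i * g.val x (g.frame x i) (g.frame x i))
          - L.kappa x * (sgn i * (g.val x (g.frame x i) u * g.val x (L.ξ x) (g.frame x i)))) := by
        refine Finset.sum_congr rfl fun i _ ↦ ?_
        rw [L.curv_xi hn]
        simp only [map_sub, map_smul, sub_apply, smul_apply, smul_eq_mul, g.symm x u]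
        ring
    _ = _ := by
        rw [Finset.sum_sub_distrib, ← Finset.mul_sum, ← Finset.mul_sum, h, h2]
        ring

/-! ### Functions with vanishing differential -/

/-- On a connected manifold, a function with zero differential is constant. -/
theorem eq_of_dAt_eq_zero [ConnectedSpace M] (hf : ∀ x, MDifferentiableAt (𝓡 n) 𝓘(ℝ) f x)
    (h : ∀ x, dAt n f x = 0) (x y : M) : f x = f y := by
  refine IsLocallyConstant.apply_eq_of_preconnectedSpace ?_ x y
  rw [IsLocallyConstant.iff_eventually_eq]
  intro x
  let φ := extChartAt (𝓡 n) x
  obtain ⟨r, hr, hB⟩ := Metric.isOpen_iff.1 (isOpen_extChartAt_target (I := 𝓡 n) x) (φ x)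
    (mem_extChartAt_target x)
  have hd : ∀ y ∈ Metric.ball (φ x) r, HasFDerivAt (f ∘ φ.symm) (0 : _ →L[ℝ] ℝ) y := by
    intro y hy
    have h1 : MDifferentiableAt 𝓘(ℝ, EuclideanSpace ℝ (Fin n)) (𝓡 n) φ.symm y :=
      ((contMDiffOn_extChartAt_symm (n := ∞) x).contMDiffAt
        ((isOpen_extChartAt_target x).mem_nhds (hB hy))).mdifferentiableAt (by simp)
    have h2 := ((hf (φ.symm y)).hasMFDerivAt.comp y h1.hasMFDerivAt)
    have h3 : mfderiv (𝓡 n) 𝓘(ℝ) f (φ.symm y) = 0 := h _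
    rw [h3, ContinuousLinearMap.zero_comp] at h2
    exact hasMFDerivAt_iff_hasFDerivAt.1 h2
  have hc : ∀ y ∈ Metric.ball (φ x) r, (f ∘ φ.symm) y = (f ∘ φ.symm) (φ x) := fun y hy ↦
    Metric.isOpen_ball.is_const_of_fderiv_eq_zero (convex_ball _ _).isPreconnected
      (fun z hz ↦ (hd z hz).differentiableAt.differentiableWithinAt) (fun z hz ↦ (hd z hz).fderiv)
      hy (Metric.mem_ball_self hr)
  have hs : φ.source ∈ 𝓝 x := extChartAt_source_mem_nhds x
  have hb : φ ⁻¹' Metric.ball (φ x) r ∈ 𝓝 x :=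
    (continuousAt_extChartAt x).preimage_mem_nhds (Metric.ball_mem_nhds _ hr)
  filter_upwards [hs, hb] with y hy1 hy2
  have := hc _ hy2
  simp only [Function.comp_apply] at this
  rwa [φ.left_inv hy1, φ.left_inv (mem_extChartAt_source x)] at this

/-! ### The pointwise algebra of the condition on the curvature -/

/-- The bilinear form `(κ/2) g - S / (2 (n - 1))`, which vanishes exactly when `S = (n - 1) κ g`. -/
def LCSStructure.defect (x : M) (u v : TangentSpace (𝓡 n) x) : ℝ :=
  L.kappa x / 2 * g.val x u v - 1 / (2 * ((n : ℝ) - 1)) * ricci g x u v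

theorem LCSStructure.inner_xi_mProj (hn : 2 ≤ n) (u v w : TangentSpace (𝓡 n) x) :
    g.val x (L.ξ x) (mProj g x u v w) =
      g.val x (L.ξ x) u * L.defect x v w - g.val x (L.ξ x) v * L.defect x u w := by
  have hn0 : 0 < n := by omega
  have hn1 : (n : ℝ) - 1 ≠ 0 := by
    have : (2 : ℝ) ≤ n := by exact_mod_cast hn
    linarith
  simp only [mProj, map_sub, map_add, map_smul, smul_eq_mul, L.inner_xi_curv hn0,
    inner_ricciOp hn0, L.ricci_xi hn0, defect]
  field_simp
  ring

theorem LCSStructure.defect_xi_left (hn : 2 ≤ n) (w : TangentSpace (𝓡 n) x) :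
    L.defect x (L.ξ x) w = 0 := by
  have hn1 : (n : ℝ) - 1 ≠ 0 := by
    have : (2 : ℝ) ≤ n := by exact_mod_cast hn
    linarith
  rw [defect, ricci_symm (by omega), L.ricci_xi (by omega)]
  field_simp
  ring

/-- The component along `ξ` of the equation `R(ξ, X) · M̃ = 0`, divided by `κ`. The endomorphism
`R(ξ, X)` is `κ (g(X, ·) ξ - η(·) X)`, so the term `R(ξ, X) (M̃(U, Y)W)` contributes the whole
tensor `g(X, M̃(U, Y)W)`, and all other terms are components of `M̃` along `ξ`. -/
theorem LCSStructure.inner_mProj (hn : 2 ≤ n) (hκ : L.kappa x ≠ 0)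
    (h : ∀ X U Y W : TangentSpace (𝓡 n) x, curvDot g x (L.ξ x) X (mProj g x) U Y W = 0)
    (X U Y W : TangentSpace (𝓡 n) x) :
    g.val x X (mProj g x U Y W) = g.val x X U * L.defect x Y W - g.val x X Y * L.defect x U W
      + g.val x (L.ξ x) W * (g.val x (L.ξ x) U * L.defect x Y X
        - g.val x (L.ξ x) Y * L.defect x U X) := by
  have hn0 : 0 < n := by omega
  have h1 := congr(g.val x (L.ξ x) $(h X U Y W))
  have d0 : ∀ w, L.defect x (L.ξ x) w = 0 := L.defect_xi_left hn
  have dsymm : ∀ u v, L.defect x u v = L.defect x v u := fun u v ↦ by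
    rw [defect, defect, ricci_symm hn0, g.symm]
  have dlin : ∀ (a b c : ℝ) (u v w : TangentSpace (𝓡 n) x),
      L.defect x (a • (b • u - c • v)) w = a * (b * L.defect x u w - c * L.defect x v w) := by
    intro a b c u v w
    simp only [defect, ← ricciHom_apply hn0, map_sub, map_smul, LinearMap.sub_apply,
      LinearMap.smul_apply, sub_apply, smul_apply, smul_eq_mul]
    ring
  have dlin' : ∀ (a b c : ℝ) (u v w : TangentSpace (𝓡 n) x),
      L.defect x w (a • (b • u - c • v)) = a * (b * L.defect x w u - c * L.defect x w v) := by
    intro a b c u v w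
    rw [dsymm, dlin, dsymm u, dsymm v]
  simp only [curvDot, L.curv_xi_left hn0, map_sub, map_zero, L.inner_xi_mProj hn, map_smul,
    smul_eq_mul, L.unit_timelike, dlin, dlin', d0, dsymm _ (L.ξ x)] at h1
  refine mul_left_cancel₀ hκ ?_
  linear_combination -h1

/-- The formula for `M̃`, solved for the curvature. -/
theorem LCSStructure.inner_curv (hn : 2 ≤ n) (hκ : L.kappa x ≠ 0)
    (h : ∀ X U Y W : TangentSpace (𝓡 n) x, curvDot g x (L.ξ x) X (mProj g x) U Y W = 0)
    (X U Y W : TangentSpace (𝓡 n) x) :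
    g.val x X (curv g x U Y W) =
      L.kappa x / 2 * (g.val x X U * g.val x Y W - g.val x X Y * g.val x U W)
      + 1 / (2 * ((n : ℝ) - 1)) * (g.val x Y W * ricci g x U X - g.val x U W * ricci g x Y X)
      + g.val x (L.ξ x) W * (g.val x (L.ξ x) U * L.defect x Y X
        - g.val x (L.ξ x) Y * L.defect x U X) := by
  have h1 := L.inner_mProj hn hκ h X U Y W
  simp only [mProj, map_sub, map_add, map_smul, smul_eq_mul, inner_ricciOp (by omega : 0 < n)] at h1
  rw [sub_eq_iff_eq_add] at h1
  rw [h1]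
  simp only [defect]
  ring

/-- At each point the Ricci tensor is a multiple of the metric: the first contraction of
`LCSStructure.inner_curv` expresses `S` through `g`, `η ⊗ η` and the scalar curvature, and the
second one determines the scalar curvature. -/
theorem LCSStructure.ricci_eq (hn : 2 ≤ n) (hκ : L.kappa x ≠ 0)
    (h : ∀ X U Y W : TangentSpace (𝓡 n) x, curvDot g x (L.ξ x) X (mProj g x) U Y W = 0)
    (u v : TangentSpace (𝓡 n) x) :
    ricci g x u v = (n - 1) * L.kappa x * g.val x u v := by
  have hn0 : 0 < n := by omega
  have hn2 : (2 : ℝ) ≤ n := by exact_mod_cast hn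
  have hn1 : (n : ℝ) - 1 ≠ 0 := by linarith
  set κ := L.kappa x
  set r : ℝ := ∑ i, sgn i * ricci g x (g.frame x i) (g.frame x i) with hr
  have hg := g.sum_frame_inner x
  have hS : ∀ u v, ∑ i, sgn i * (g.val x (g.frame x i) u * ricci g x v (g.frame x i)) =
      ricci g x v u := fun u v ↦ g.sum_frame_mul x (ricciHom hn0 g x v) u
  have hG : ∀ u v, ∑ i, sgn i * (g.val x (g.frame x i) u * g.val x v (g.frame x i)) =
      g.val x v u := fun u v ↦ g.sum_frame_mul x (g.val x v).toLinearMap u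
  -- Contraction of the formula for the curvature.
  have key : ∀ Y W, ricci g x Y W = κ / 2 * (n - 1) * g.val x Y W
      + 1 / (2 * ((n : ℝ) - 1)) * (r * g.val x Y W - ricci g x Y W)
      - g.val x (L.ξ x) Y * g.val x (L.ξ x) W * (n * κ / 2 - 1 / (2 * ((n : ℝ) - 1)) * r) := by
    intro Y W
    have hterm : ∀ i, sgn i * g.val x (curv g x (g.frame x i) Y W) (g.frame x i) =
        κ / 2 * (g.val x Y W * (sgn i * g.val x (g.frame x i) (g.frame x i))
          - sgn i * (g.val x (g.frame x i) Y * g.val x W (g.frame x i)))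
        + 1 / (2 * ((n : ℝ) - 1)) * (g.val x Y W * (sgn i * ricci g x (g.frame x i) (g.frame x i))
          - sgn i * (g.val x (g.frame x i) W * ricci g x Y (g.frame x i)))
        + g.val x (L.ξ x) W *
          (κ / 2 * (sgn i * (g.val x (g.frame x i) (L.ξ x) * g.val x Y (g.frame x i)))
          - 1 / (2 * ((n : ℝ) - 1)) *
            (sgn i * (g.val x (g.frame x i) (L.ξ x) * ricci g x Y (g.frame x i)))
          - g.val x (L.ξ x) Y * (κ / 2 * (sgn i * g.val x (g.frame x i) (g.frame x i))
            - 1 / (2 * ((n : ℝ) - 1)) * (sgn i * ricci g x (g.frame x i) (g.frame x i)))) := by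
      intro i
      rw [g.symm, L.inner_curv hn hκ h, g.symm x (g.frame x i) W, g.symm x (g.frame x i) (L.ξ x)]
      simp only [LCSStructure.defect]
      ring
    conv_lhs => rw [ricci, Finset.sum_congr rfl fun i _ ↦ hterm i]
    simp only [Finset.sum_add_distrib, Finset.sum_sub_distrib, ← Finset.mul_sum, hS, hG, hg, ← hr,
      L.ricci_xi hn0]
    rw [g.symm x W Y, g.symm x Y (L.ξ x)]
    simp only [κ]
    field_simp
    ring
  -- A second contraction determines the scalar curvature.
  have hr' : r = n * (n - 1) * κ := by
    have hterm : ∀ i, sgn i * ricci g x (g.frame x i) (g.frame x i) =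
        (κ / 2 * (n - 1) + 1 / (2 * ((n : ℝ) - 1)) * r) *
          (sgn i * g.val x (g.frame x i) (g.frame x i))
        - 1 / (2 * ((n : ℝ) - 1)) * (sgn i * ricci g x (g.frame x i) (g.frame x i))
        - (n * κ / 2 - 1 / (2 * ((n : ℝ) - 1)) * r) *
          (sgn i * (g.val x (g.frame x i) (L.ξ x) * g.val x (L.ξ x) (g.frame x i))) := by
      intro i
      rw [g.symm x (g.frame x i) (L.ξ x)]
      linear_combination sgn i * key (g.frame x i) (g.frame x i)
    have h1 : r = (κ / 2 * (n - 1) + 1 / (2 * ((n : ℝ) - 1)) * r) * n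
        - 1 / (2 * ((n : ℝ) - 1)) * r + (n * κ / 2 - 1 / (2 * ((n : ℝ) - 1)) * r) := by
      conv_lhs => rw [hr, Finset.sum_congr rfl fun i _ ↦ hterm i]
      simp only [Finset.sum_sub_distrib, ← Finset.mul_sum, hG, hg, ← hr, L.unit_timelike]
      ring
    field_simp at h1
    have h2 : (n : ℝ) * (r - n * (n - 1) * κ) = 0 := by linear_combination h1
    have hnn : (n : ℝ) ≠ 0 := by linarith
    linarith [(mul_eq_zero.1 h2).resolve_left hnn]
  have h1 := key u v
  rw [hr'] at h1
  field_simp at h1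
  have h2 : (2 * (n : ℝ) - 1) * (ricci g x u v - (n - 1) * κ * g.val x u v) = 0 := by
    linear_combination h1
  have hnn : 2 * (n : ℝ) - 1 ≠ 0 := by linarith
  linarith [(mul_eq_zero.1 h2).resolve_left hnn]

/-- At each point the sectional curvature is constant, with value `κ`. -/
theorem LCSStructure.curv_eq (hn : 2 ≤ n) (hκ : L.kappa x ≠ 0)
    (h : ∀ X U Y W : TangentSpace (𝓡 n) x, curvDot g x (L.ξ x) X (mProj g x) U Y W = 0)
    (u v w : TangentSpace (𝓡 n) x) :
    curv g x u v w = L.kappa x • (g.val x v w • u - g.val x u w • v) := by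
  have hn1 : (n : ℝ) - 1 ≠ 0 := by
    have : (2 : ℝ) ≤ n := by exact_mod_cast hn
    linarith
  rw [← sub_eq_zero]
  refine g.nondegenerate x _ fun z ↦ ?_
  rw [map_sub, sub_apply, g.symm x (curv g x u v w), L.inner_curv hn hκ h]
  simp only [defect, L.ricci_eq hn hκ h, map_sub, map_smul, sub_apply, smul_apply, smul_eq_mul,
    g.symm x z]
  field_simp
  ring

/-! ### Schur's lemma -/

/-- Schur's lemma: in dimension at least three the curvature of a metric of pointwise constant
curvature has zero differential. -/
theorem dAt_eq_zero_of_curv_eq (hn : 3 ≤ n) (hf : ∀ x, ContMDiffAt (𝓡 n) 𝓘(ℝ) ∞ f x)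
    (h : ∀ (x : M) (u v w : TangentSpace (𝓡 n) x),
      curv g x u v w = f x • (g.val x v w • u - g.val x u w • v)) (x : M) : dAt n f x = 0 := by
  have hn0 : 0 < n := by omega
  have D := isLeviCivita_leviCivita g
  -- The second Bianchi identity: the terms that do not contain the differential of `f` cancel.
  have key : ∀ u v w : TangentSpace (𝓡 n) x, ∀ z : TangentSpace (𝓡 n) x,
      dAt n f x u • (g.val x w z • v - g.val x v z • w)
      + dAt n f x v • (g.val x u z • w - g.val x w z • u)
      + dAt n f x w • (g.val x v z • u - g.val x u z • v) = 0 := by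
    intro u v w z
    have hW := smoothAt_extAt z
    have hfd := (hf x).mdifferentiableAt (n := ∞) (by simp)
    have hF : ∀ {Y Z : VField n M}, SmoothAt Y x → SmoothAt Z x →
        (∀ᶠ y in 𝓝 x, SmoothAt Y y) → (∀ᶠ y in 𝓝 x, SmoothAt Z y) → ∀ X : VField n M,
        cov g X (curvField g Y Z (extAt z)) x =
          dAt n f x (X x) • (g.val x (Z x) z • Y x - g.val x (Y x) z • Z x)
          + f x • ((g.val x (cov g X Z x) z + g.val x (Z x) (cov g X (extAt z) x)) • Y x
            + g.val x (Z x) z • cov g X Y x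
            - (g.val x (cov g X Y x) z + g.val x (Y x) (cov g X (extAt z) x)) • Z x
            - g.val x (Y x) z • cov g X Z x) := by
      intro Y Z hY hZ hY' hZ' X
      have e1 : curvField g Y Z (extAt z) =ᶠ[𝓝 x]
          f • (g.inner Z (extAt z) • Y - g.inner Y (extAt z) • Z) := by
        filter_upwards [hY', hZ', eventually_smoothAt_extAt z] with y h1 h2 h3
        rw [curvField_apply hn0 g h1 h2 h3, h]
        rfl
      have s1 := SmoothAt.smul (smoothAt_inner g hZ hW) hY
      have s2 := SmoothAt.smul (smoothAt_inner g hY hW) hZ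
      have d1 := (smoothAt_inner g hZ hW).mdifferentiableAt (by simp)
      have d2 := (smoothAt_inner g hY hW).mdifferentiableAt (by simp)
      rw [cov_congr g (hY.curvField g hZ hW).diffAt (SmoothAt.smul (hf x) (s1.sub s2)).diffAt e1,
        cov_smul_right g hfd (s1.sub s2).diffAt, cov_sub_right g s1.diffAt s2.diffAt,
        cov_smul_right g d1 hY.diffAt, cov_smul_right g d2 hZ.diffAt,
        D.metric hZ.diffAt hW.diffAt, D.metric hY.diffAt hW.diffAt]
      simp only [LorentzMetric.inner, Pi.sub_apply, Pi.smul_apply', extAt_apply, cov]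
      module
    have hX := smoothAt_extAt u
    have hY := smoothAt_extAt v
    have hZ := smoothAt_extAt w
    have eX := eventually_smoothAt_extAt u
    have eY := eventually_smoothAt_extAt v
    have eZ := eventually_smoothAt_extAt w
    have hb := curvField_bianchi g hX hY hZ hW
    rw [hF hY hZ eY eZ, hF hZ hX eZ eX, hF hX hY eX eY,
      curvField_apply hn0 g hY hZ (hX.cov g hW), curvField_apply hn0 g hZ hX (hY.cov g hW),
      curvField_apply hn0 g hX hY (hZ.cov g hW), curvField_apply hn0 g (hY.bracket hZ) hX hW,
      curvField_apply hn0 g (hZ.bracket hX) hY hW, curvField_apply hn0 g (hX.bracket hY) hZ hW,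
      ← cov_torsion g hY.diffAt hZ.diffAt, ← cov_torsion g hZ.diffAt hX.diffAt,
      ← cov_torsion g hX.diffAt hY.diffAt] at hb
    simp only [extAt_apply, h, map_sub, sub_apply] at hb
    rw [← sub_eq_zero] at hb
    rw [← hb]
    module
  -- Evaluation on the vectors `e_i`, `e_j`, `e_k`, `e_k` of an orthonormal frame.
  suffices hi : ∀ i, dAt n f x (g.frame x i) = 0 by
    ext1 u
    rw [← (g.frame x).sum_repr u]
    simp only [map_sum, map_smul, hi, smul_zero, Finset.sum_const_zero, zero_apply]
  intro i
  obtain ⟨j, hj⟩ : ∃ j : Fin n, j ≠ i := by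
    have : Nontrivial (Fin n) := Fin.nontrivial_iff_two_le.2 (by omega)
    exact exists_ne i
  obtain ⟨k, hk⟩ : ∃ k : Fin n, k ∉ ({i, j} : Finset (Fin n)) := by
    by_contra! hc
    have h1 : Finset.univ ⊆ ({i, j} : Finset (Fin n)) := fun k _ ↦ hc k
    have h2 := (Finset.card_le_card h1).trans Finset.card_le_two
    simp only [Finset.card_univ, Fintype.card_fin] at h2
    omega
  simp only [Finset.mem_insert, Finset.mem_singleton, not_or] at hk
  have h1 := congr(g.val x (g.frame x j)
    $(key (g.frame x i) (g.frame x j) (g.frame x k) (g.frame x k)))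
  have hs : ∀ i : Fin n, sgn i ≠ 0 := fun i hi ↦ by simpa [hi] using sgn_mul_self i
  simp only [map_add, map_sub, map_smul, smul_eq_mul, g.frame_inner, if_true, hj,
    Ne.symm hk.1, Ne.symm hk.2, if_false, map_zero] at h1
  simpa [hs] using h1

end LCS

end

theorem theorem6p2 {n : ℕ} (hn : 3 ≤ n) {M : Type*} [TopologicalSpace M]
    [ChartedSpace (EuclideanSpace ℝ (Fin n)) M] [IsManifold (𝓡 n) ∞ M]
    [T2Space M] [ParacompactSpace M] [ConnectedSpace M]
    (g : LCS.LorentzMetric n M) (L : LCS.LCSStructure g)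
    (V : LCS.VField n M) (lam p : M → ℝ) (hsol : LCS.IsConformalRicciSoliton g V lam p)
    (hRM : ∀ (x : M) (X U Y W : TangentSpace (𝓡 n) x),
      LCS.curvDot g x (L.ξ x) X (LCS.mProj g x) U Y W = 0)
    (hne : ∀ x : M, L.α x ^ 2 - L.ρ x ≠ 0) :
    LCS.IsEinstein g := by
  have hn2 : 2 ≤ n := by omega
  have hd := LCS.dAt_eq_zero_of_curv_eq hn L.smooth_kappa fun x ↦ L.curv_eq hn2 (hne x) (hRM x)
  obtain ⟨x₀⟩ : Nonempty M := inferInstance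
  refine ⟨(n - 1) * L.kappa x₀, fun x u v ↦ ?_⟩
  rw [L.ricci_eq hn2 (hne x) (hRM x), LCS.eq_of_dAt_eq_zero
    (fun y ↦ (L.smooth_kappa y).mdifferentiableAt (by simp)) hd x x₀]
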